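/- Let $N\ge 1$, let $\Omega\subset\mathbb R^N$ be open and bounded, $T>0$, and $\mathcal Q=\Omega\times(0,T)$. Let $h:\mathbb R\to\mathbb R$ be locally Lipschitz with $h(0)=0$ and $|h(l)|/|l|\to\infty$ as $|l|\to\infty$, and put $H(r)=\int_0^r\frac{dl}{|h(l)|+1}$. Let $\alpha>0$, $E\in (L^2(\mathcal Q))^N$ and $f\in L^1(\mathcal Q)$. Then there is a constant $C>0$, depending only on $\alpha,E,f$ (and on the fixed $N,\Omega,T,h$), with the following property. Let $\beta>0$, and let $\mathcal M$ be a measurable $N\times N$ matrix field on $\mathcal Q$ with $\alpha|\xi|^2\le\mathcal M(x,t)\xi\cdot\xi\le\beta|\xi|^2$ for a.e. $(x,t)\in\mathcal Q$ and all $\xi\in\mathbb R^N$. For $n\in\mathbb N$ let $E_n$, $f_n$ be measurable with $|E_n|\le|E|$, $|f_n|\le|f|$ a.e. in $\mathcal Q$, and let $u_n\in L^2(0,T;W^{1,2}_0(\Omega))\cap C^0([0,T];L^2(\Omega))$, with $\partial_t u_n\in L^2(0,T;W^{-1,2}(\Omega))$ and $u_n(\cdot,0)=0$, be a weak solution of $$\partial_t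 u_n-\operatorname{div}(\mathcal M\nabla u_n)=-\operatorname{div}F_n+f_n,$$ that is, for every $\phi\in L^2(0,T;W^{1,2}_0(\Omega))$ the functions $\mathcal M\nabla u_n\cdot\nabla\phi$, $F_n\cdot\nabla\phi$ and $f_n\phi$ are integrable on $\mathcal Q$ and $$\int_0^T\langle\partial_t u_n,\phi\rangle\,dt+\int_{\mathcal Q}\mathcal M\nabla u_n\cdot\nabla\phi=\int_{\mathcal Q}F_n\cdot\nabla\phi+\int_{\mathcal Q}f_n\phi .$$ Here either $F_n=h(u_n)E_n$ for all $n$; or $F_n=h(T_n(u_n))E_n$ for all $n$, where $T_n(s)=\max(-n,\min(n,s))$, and in this second case $h$ is such that, for some $L$, $|h(T_m(s))|\le L(|h(s)|+1)$ for all $m\in\mathbb N$, $s\in\mathbb R$ (which holds with $L=1$ if $h$ is nondecreasing, in particular for $h(l)=l\log(e+|l|)$). Then, for all $n\in\mathbb N$ and all $k\ge 0$, $$|\{u_n>k\}|\,|H(k)|^{\frac{2(N+2)}N}\le C,\qquad |\{u_n<-k\}|\,|H(-k)|^{\frac{2(N+2)}N}\le C,$$ $$|\{|u_n|>k\}|\,\min\big(|H(k)|,|H(-k)|\big)^{\frac{2(N+2)}N}\le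 C .$$ In particular, if $|h|$ is even, then $$|\{|u_n|>k\}|\le\frac{C}{|H(k)|^{\frac{2(N+2)}N}}\qquad\text{for all } n\in\mathbb N,\ k>0 .$$ -/

import Mathlib

open MeasureTheory Set Filter Topology
open scoped ContDiff

noncomputable section

namespace ParabolicDecay

/-- The space `ℝ^N` with its Euclidean norm. -/
abbrev Space (N : ℕ) : Type := EuclideanSpace ℝ (Fin N)

/-- The cylinder `Q = Ω × (0,T)`. -/
def cyl {N : ℕ} (Ω : Set (Space N)) (T : ℝ) : Set (Space N × ℝ) := Ω ×ˢ Ioo 0 T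

/-- Lebesgue measure on the cylinder `Q = Ω × (0,T)`. -/
def cylMeasure {N : ℕ} (Ω : Set (Space N)) (T : ℝ) : Measure (Space N × ℝ) :=
  volume.restrict (cyl Ω T)

/-- `v ∈ W₀^{1,2}(Ω)` with weak gradient `Dv`: the pair `(v, Dv)` is the limit in `L²(Ω)` of
`(ψ_j, ∇ψ_j)` for a sequence `ψ_j ∈ C_c^∞(Ω)`. -/
def MemW012 {N : ℕ} (Ω : Set (Space N)) (v : Space N → ℝ) (Dv : Space N → Space N) : Prop :=
  MemLp v 2 (volume.restrict Ω) ∧ MemLp Dv 2 (volume.restrict Ω) ∧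
  ∃ ψ : ℕ → Space N → ℝ,
    (∀ j, ContDiff ℝ ∞ (ψ j) ∧ HasCompactSupport (ψ j) ∧ tsupport (ψ j) ⊆ Ω) ∧
    Tendsto (fun j => eLpNorm (fun x => ψ j x - v x) 2 (volume.restrict Ω)) atTop (𝓝 0) ∧
    Tendsto (fun j => eLpNorm (fun x => gradient (ψ j) x - Dv x) 2 (volume.restrict Ω))
      atTop (𝓝 0)

/-- `v ∈ L²(0,T; W₀^{1,2}(Ω))` with spatial weak gradient `Dv`. -/
def MemL2W012 {N : ℕ} (Ω : Set (Space N)) (T : ℝ)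
    (v : Space N × ℝ → ℝ) (Dv : Space N × ℝ → Space N) : Prop :=
  MemLp v 2 (cylMeasure Ω T) ∧ MemLp Dv 2 (cylMeasure Ω T) ∧
  ∀ᵐ t ∂(volume.restrict (Ioo 0 T)), MemW012 Ω (fun x => v (x, t)) (fun x => Dv (x, t))

/-- The distributional time derivative of `u` on `Q` is the element `g₀ - div g` of
`L²(0,T; W^{-1,2}(Ω))`, where `g₀ ∈ L²(Q)` and `g ∈ L²(Q)^N`; it acts on
`φ ∈ L²(0,T; W₀^{1,2}(Ω))` as `∫_Q (g₀ φ + g · ∇φ)`. Every element of the dual space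
`L²(0,T; W^{-1,2}(Ω))` has this form. -/
def HasTimeDerivative {N : ℕ} (Ω : Set (Space N)) (T : ℝ) (u : Space N × ℝ → ℝ)
    (g₀ : Space N × ℝ → ℝ) (g : Space N × ℝ → Space N) : Prop :=
  MemLp g₀ 2 (cylMeasure Ω T) ∧ MemLp g 2 (cylMeasure Ω T) ∧
  ∀ ψ : Space N × ℝ → ℝ, ContDiff ℝ ∞ ψ → HasCompactSupport ψ → tsupport ψ ⊆ cyl Ω T →
    -∫ z, u z * deriv (fun s => ψ (z.1, s)) z.2 ∂(cylMeasure Ω T) =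
      ∫ z, (g₀ z * ψ z + inner ℝ (g z) (gradient (fun y => ψ (y, z.2)) z.1)) ∂(cylMeasure Ω T)

/-- `u` has a representative in `C⁰([0,T]; L²(Ω))` which vanishes at time `0`. -/
def ContinuousInL2WithZeroInitialDatum {N : ℕ} (Ω : Set (Space N)) (T : ℝ)
    (u : Space N × ℝ → ℝ) : Prop :=
  ∃ U : ℝ → Lp ℝ 2 (volume.restrict Ω), ContinuousOn U (Icc 0 T) ∧ U 0 = 0 ∧
    ∀ᵐ t ∂(volume.restrict (Ioo 0 T)), (fun x => u (x, t)) =ᵐ[volume.restrict Ω] U t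

/-- `u ∈ L²(0,T; W₀^{1,2}(Ω)) ∩ C⁰([0,T]; L²(Ω))` is a weak solution of
`∂_t u - div(M ∇u) = -div F + f` in `Q`, `u = 0` on `∂Ω × (0,T)`, `u(·,0) = 0`,
tested with all `φ ∈ L²(0,T; W₀^{1,2}(Ω))`. All the integrals are required to exist. -/
def IsWeakSolution {N : ℕ} (Ω : Set (Space N)) (T : ℝ)
    (M : Space N × ℝ → Matrix (Fin N) (Fin N) ℝ) (F : Space N × ℝ → Space N)
    (f : Space N × ℝ → ℝ) (u : Space N × ℝ → ℝ) : Prop :=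
  ∃ (Du : Space N × ℝ → Space N) (g₀ : Space N × ℝ → ℝ) (g : Space N × ℝ → Space N),
    MemL2W012 Ω T u Du ∧
    HasTimeDerivative Ω T u g₀ g ∧
    ContinuousInL2WithZeroInitialDatum Ω T u ∧
    ∀ (φ : Space N × ℝ → ℝ) (Dφ : Space N × ℝ → Space N), MemL2W012 Ω T φ Dφ →
      Integrable (fun z => inner ℝ (Matrix.toEuclideanLin (M z) (Du z)) (Dφ z))
        (cylMeasure Ω T) ∧
      Integrable (fun z => inner ℝ (F z) (Dφ z)) (cylMeasure Ω T) ∧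
      Integrable (fun z => f z * φ z) (cylMeasure Ω T) ∧
      (∫ z, (g₀ z * φ z + inner ℝ (g z) (Dφ z)) ∂(cylMeasure Ω T)) +
        (∫ z, inner ℝ (Matrix.toEuclideanLin (M z) (Du z)) (Dφ z) ∂(cylMeasure Ω T)) =
      (∫ z, inner ℝ (F z) (Dφ z) ∂(cylMeasure Ω T)) + ∫ z, f z * φ z ∂(cylMeasure Ω T)

/-- `M` is a measurable matrix field on `Q` with
`α |ξ|² ≤ M(x,t) ξ · ξ ≤ β |ξ|²` for a.e. `(x,t) ∈ Q` and all `ξ`. -/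
def IsElliptic {N : ℕ} (Ω : Set (Space N)) (T α β : ℝ)
    (M : Space N × ℝ → Matrix (Fin N) (Fin N) ℝ) : Prop :=
  (∀ i j, AEMeasurable (fun z => M z i j) (cylMeasure Ω T)) ∧
  ∀ᵐ z ∂(cylMeasure Ω T), ∀ ξ : Space N,
    α * ‖ξ‖ ^ 2 ≤ inner ℝ (Matrix.toEuclideanLin (M z) ξ) ξ ∧
    inner ℝ (Matrix.toEuclideanLin (M z) ξ) ξ ≤ β * ‖ξ‖ ^ 2

/-- The truncation `T_n(s) = max(-n, min(n, s))`. -/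
def trunc (n : ℕ) (s : ℝ) : ℝ := max (-(n : ℝ)) (min (n : ℝ) s)

/-- `H(r) = ∫_0^r dl / (|h(l)| + 1)`. -/
def Hfun (h : ℝ → ℝ) (r : ℝ) : ℝ := ∫ l in (0 : ℝ)..r, 1 / (|h l| + 1)

end ParabolicDecay

end

namespace ParabolicDecay

open scoped ENNReal

/-! The equation is tested with `ψ(u)`, where `ψ' = η²` and `η` is a smooth positive weight
comparable to `1/(|h|+1)`. Let `G` and `Ψ` be the primitives of `η` and `ψ` vanishing at 0. In the
drift term `|h| η ≤ 1`, so only `|E| |∇G(u)|` remains (up to the factor `L` when `h` is truncated),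
and ellipticity absorbs it. Superlinear growth of `h` forces `η(s) ≤ C/(1+|s|)`; hence `η²` is
integrable, `ψ` is bounded, and the source term needs `f` only in L¹. The time term yields `∫
Ψ(u(τ))`, and `G² ≤ K Ψ`. Thus `G(u)` is bounded in L^∞(0,T;L²) and in L²(0,T;W₀^{1,2}) by
quantities that depend on the data alone (`exists_auxiliary_functions`,
`IsWeakSolution.energy_estimate`).

The Gagliardo-Nirenberg inequality `∫ |v|^(2+4/N) ≤ c (∫ |v|²)^(2/N) ∫ |∇v|²`, applied on time
slices and integrated in time, then bounds `G(u)` in L^{2+4/N}(Q)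
(`exists_lintegral_pow_le_of_memW012`, `IsWeakSolution.lintegral_pow_le`). Since `2+4/N = 2(N+2)/N`,
`|H| ≤ 4|G|`, and `|H|` is monotone on each half-line, Chebyshev's inequality gives the decay of the
level sets.

The delicate point is the time term, since `∂_t u` is only a functional on L²(0,T;W₀^{1,2}).
Convexity of `Ψ` gives `Ψ(a) - Ψ(b) ≤ ψ(a)(a - b)`; with `a = u(t)`, `b = u(t-r)`, integration over
Ω bounds the increment of `∫ Ψ(u)` by `∂_t u` over the window `(t-r,t)` paired with the frozen
function `ψ(u(t))`. Averaging in `t` and letting `r → 0` yields the one-sided chain rule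
`integral_comp_le_integral_flux`, which suffices. -/

/-! ### Gagliardo-Nirenberg inequality for compactly supported C¹ functions. -/

/-- In one dimension a compactly supported function is bounded by the integral of its derivative. -/
theorem enorm_le_lintegral_fderiv_of_space_one {v : Space 1 → ℝ} (hv : ContDiff ℝ 1 v)
    (hc : HasCompactSupport v) (x : Space 1) : ‖v x‖ₑ ≤ ∫⁻ y, ‖fderiv ℝ v y‖ₑ := by
  let e : ℝ ≃ₗᵢ[ℝ] Space 1 := (OrthonormalBasis.singleton (Fin 1) ℝ).repr
  have hmp : MeasurePreserving e := e.measurePreserving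
  have h1 : ContDiff ℝ 1 (v ∘ e) := hv.comp e.contDiff
  have h2 : HasCompactSupport (v ∘ e) := hc.comp_homeomorph e.toHomeomorph
  have h3 := HasCompactSupport.enorm_le_lintegral_Ici_deriv h1 h2 (e.symm x)
  simp only [Function.comp_apply, LinearIsometryEquiv.apply_symm_apply] at h3
  refine h3.trans ((setLIntegral_le_lintegral _ _).trans ?_)
  have h4 : ∫⁻ y, ‖fderiv ℝ v y‖ₑ = ∫⁻ s, ‖fderiv ℝ v (e s)‖ₑ :=
    (hmp.lintegral_comp_emb e.toHomeomorph.measurableEmbedding _).symm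
  rw [h4]
  refine lintegral_mono fun s => ?_
  have hd : HasDerivAt (v ∘ e) (fderiv ℝ v (e s) (e 1)) s := by
    have ha : HasFDerivAt v (fderiv ℝ v (e s)) (e s) :=
      (hv.differentiable one_ne_zero _).hasFDerivAt
    have hb : HasDerivAt e (e 1) s := by
      have := (e.toContinuousLinearEquiv.toContinuousLinearMap).hasDerivAt (x := s)
      simpa using this
    exact ha.comp_hasDerivAt s hb
  have h5 : ‖deriv (v ∘ e) s‖ ≤ ‖fderiv ℝ v (e s)‖ := by
    rw [hd.deriv]
    refine (ContinuousLinearMap.le_opNorm _ _).trans ?_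
    simp
  exact enorm_le_iff_norm_le.mpr h5

/-- The interpolation inequality behind the Gagliardo-Nirenberg inequality. -/
theorem exists_lintegral_pow_le_mul_lintegral_fderiv (N : ℕ) (hN : 1 ≤ N) :
    ∃ K : ℝ≥0∞, K ≠ ⊤ ∧ ∀ w : Space N → ℝ, ContDiff ℝ 1 w → HasCompactSupport w →
      ∫⁻ x, ‖w x‖ₑ ^ (2 + 4 / (N : ℝ)) ≤ K * (∫⁻ x, ‖w x‖ₑ ^ (2 : ℝ)) ^ (1 / (N : ℝ)) *
        ∫⁻ x, ‖fderiv ℝ (fun y => ‖w y‖ ^ (2 + 2 / (N : ℝ))) x‖ₑ := by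
  have hNpos : (0 : ℝ) < N := by exact_mod_cast hN
  have hq0 : (0 : ℝ) ≤ 2 + 2 / (N : ℝ) := by positivity
  have hq1 : (1 : ℝ) < 2 + 2 / (N : ℝ) := by
    have : (0 : ℝ) < 2 / (N : ℝ) := by positivity
    linarith
  have hpow : ∀ (w : Space N → ℝ) (x : Space N),
      ‖‖w x‖ ^ (2 + 2 / (N : ℝ))‖ₑ = ‖w x‖ₑ ^ (2 + 2 / (N : ℝ)) := by
    intro w x
    rw [Real.enorm_rpow_of_nonneg (norm_nonneg _) hq0, enorm_norm]
  have hsupp : ∀ w : Space N → ℝ, HasCompactSupport w →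
      HasCompactSupport (fun y => ‖w y‖ ^ (2 + 2 / (N : ℝ))) := by
    intro w hw
    refine hw.comp_left (g := fun s : ℝ => ‖s‖ ^ (2 + 2 / (N : ℝ))) ?_
    rw [norm_zero, Real.zero_rpow (by linarith)]
  rcases Nat.lt_or_ge 1 N with h1 | h1
  · have hN1 : (1 : ℝ) < N := by exact_mod_cast h1
    have hconj : (N : ℝ).HolderConjugate (N / (N - 1)) := Real.HolderConjugate.conjExponent hN1
    have hconj' : ((Module.finrank ℝ (Space N) : ℕ) : ℝ).HolderConjugate ((N : ℝ) / (N - 1)) := by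
      rw [finrank_euclideanSpace_fin]; exact hconj
    set p : ℝ := (N : ℝ) / (N - 1) with hp
    have hp0 : 0 < p := hconj.symm.pos
    set C : ℝ≥0∞ := ((lintegralPowLePowLIntegralFDerivConst (volume : Measure (Space N)) p :
      NNReal) : ℝ≥0∞) with hC
    refine ⟨C ^ (1 / p), ?_, fun w hw hwc => ?_⟩
    · exact ENNReal.rpow_ne_top_of_nonneg (by positivity) ENNReal.coe_ne_top
    set D := ∫⁻ x, ‖fderiv ℝ (fun y => ‖w y‖ ^ (2 + 2 / (N : ℝ))) x‖ₑ with hD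
    have hS := lintegral_pow_le_pow_lintegral_fderiv (volume : Measure (Space N))
      (hw.norm_rpow hq1) (hsupp w hwc) hconj'
    simp only [hpow] at hS
    have hwm : AEMeasurable (fun x => ‖w x‖ₑ) volume := hw.continuous.aemeasurable.enorm
    -- Hölder with weights `1/N` and `1/p`, where `p = N/(N-1)`: the exponents combine to `2/N + (2
    -- + 2/N) = 2 + 4/N`. The second factor is the one that the L¹ Sobolev inequality for
    -- `|w|^(2+2/N)` controls.
    have hI := ENNReal.lintegral_mul_norm_pow_le (μ := (volume : Measure (Space N)))
      (f := fun x => ‖w x‖ₑ ^ (2 : ℝ)) (g := fun x => (‖w x‖ₑ ^ (2 + 2 / (N : ℝ))) ^ p)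
      (hwm.pow_const _) ((hwm.pow_const _).pow_const _) (p := 1 / N) (q := 1 / p)
      (by positivity) (by positivity) (by simpa using hconj.inv_add_inv_eq_one)
    have hEq : ∀ x, (‖w x‖ₑ ^ (2 : ℝ)) ^ (1 / (N : ℝ)) *
        ((‖w x‖ₑ ^ (2 + 2 / (N : ℝ))) ^ p) ^ (1 / p) = ‖w x‖ₑ ^ (2 + 4 / (N : ℝ)) := by
      intro x
      rw [← ENNReal.rpow_mul, ← ENNReal.rpow_mul, ← ENNReal.rpow_mul,
        ← ENNReal.rpow_add_of_nonneg _ _ (by positivity) (by positivity)]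
      congr 1
      field_simp
      ring
    simp only [hEq] at hI
    refine hI.trans ?_
    rw [mul_comm (C ^ (1 / p)), mul_assoc]
    gcongr
    calc (∫⁻ x, (‖w x‖ₑ ^ (2 + 2 / (N : ℝ))) ^ p) ^ (1 / p) ≤ (C * D ^ p) ^ (1 / p) := by
          gcongr
      _ = C ^ (1 / p) * D := by
          rw [ENNReal.mul_rpow_of_nonneg _ _ (by positivity), ← ENNReal.rpow_mul,
            mul_one_div_cancel hp0.ne', ENNReal.rpow_one]
  -- The conjugate exponent is infinite here, so the sup bound on `|w|^4` replaces Sobolev, and `6 =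
  -- 2 + 4`.
  · obtain rfl : N = 1 := le_antisymm h1 hN
    refine ⟨1, ENNReal.one_ne_top, fun w hw hwc => ?_⟩
    set D := ∫⁻ x, ‖fderiv ℝ (fun y => ‖w y‖ ^ (2 + 2 / ((1 : ℕ) : ℝ))) x‖ₑ with hD
    have hb : ∀ x, ‖w x‖ₑ ^ (2 + 2 / ((1 : ℕ) : ℝ)) ≤ D := fun x => by
      have := enorm_le_lintegral_fderiv_of_space_one (hw.norm_rpow hq1) (hsupp w hwc) x
      rwa [hpow] at this
    have hwm : AEMeasurable (fun x => ‖w x‖ₑ ^ (2 : ℝ)) volume :=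
      hw.continuous.aemeasurable.enorm.pow_const _
    calc ∫⁻ x, ‖w x‖ₑ ^ (2 + 4 / ((1 : ℕ) : ℝ))
        ≤ ∫⁻ x, ‖w x‖ₑ ^ (2 : ℝ) * D := by
          refine lintegral_mono fun x => ?_
          have : (2 + 4 / ((1 : ℕ) : ℝ)) = 2 + (2 + 2 / ((1 : ℕ) : ℝ)) := by norm_num
          rw [this, ENNReal.rpow_add_of_nonneg _ _ (by norm_num) (by norm_num)]
          gcongr
          exact hb x
      _ = 1 * (∫⁻ x, ‖w x‖ₑ ^ (2 : ℝ)) ^ (1 / ((1 : ℕ) : ℝ)) * D := by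
          rw [lintegral_mul_const'' _ hwm]
          simp

/-- The Gagliardo-Nirenberg inequality for compactly supported functions. -/
theorem exists_lintegral_pow_le (N : ℕ) (hN : 1 ≤ N) :
    ∃ K : ℝ≥0∞, K ≠ ⊤ ∧ ∀ w : Space N → ℝ, ContDiff ℝ 1 w → HasCompactSupport w →
      ∫⁻ x, ‖w x‖ₑ ^ (2 + 4 / (N : ℝ)) ≤ K * (∫⁻ x, ‖w x‖ₑ ^ (2 : ℝ)) ^ (2 / (N : ℝ)) *
        ∫⁻ x, ‖fderiv ℝ w x‖ₑ ^ (2 : ℝ) := by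
  obtain ⟨K, hK, hle⟩ := exists_lintegral_pow_le_mul_lintegral_fderiv N hN
  have hNpos : (0 : ℝ) < N := by exact_mod_cast hN
  have hq1 : (1 : ℝ) < 2 + 2 / (N : ℝ) := by
    have : (0 : ℝ) < 2 / (N : ℝ) := by positivity
    linarith
  set q : ℝ := 2 + 2 / (N : ℝ) with hq
  set c : ℝ≥0∞ := ENNReal.ofReal q with hc
  refine ⟨(K * c) ^ (2 : ℝ), ?_, fun w hw hwc => ?_⟩
  · exact ENNReal.rpow_ne_top_of_nonneg (by norm_num) (ENNReal.mul_ne_top hK ENNReal.ofReal_ne_top)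
  have hwm : AEMeasurable (fun x => ‖w x‖ₑ) volume := hw.continuous.aemeasurable.enorm
  have hdm : AEMeasurable (fun x => ‖fderiv ℝ w x‖ₑ) volume :=
    (hw.continuous_fderiv one_ne_zero).aemeasurable.enorm
  set A := ∫⁻ x, ‖w x‖ₑ ^ (2 + 4 / (N : ℝ)) with hA
  set W := ∫⁻ x, ‖w x‖ₑ ^ (2 : ℝ) with hW
  set B := ∫⁻ x, ‖fderiv ℝ w x‖ₑ ^ (2 : ℝ) with hB
  -- Finiteness is what permits dividing by `A^(1/2)` below.
  have hAfin : A ≠ ⊤ := by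
    have hcont : Continuous (fun x => ‖w x‖ ^ (2 + 4 / (N : ℝ))) :=
      hw.continuous.norm.rpow_const fun x => Or.inr (by positivity)
    have hcs : HasCompactSupport (fun x => ‖w x‖ ^ (2 + 4 / (N : ℝ))) := by
      refine hwc.comp_left (g := fun s : ℝ => ‖s‖ ^ (2 + 4 / (N : ℝ))) ?_
      rw [norm_zero, Real.zero_rpow (by positivity)]
    have hint := (hcont.integrable_of_hasCompactSupport hcs (μ := volume)).2.ne
    have : A = ∫⁻ x, ‖‖w x‖ ^ (2 + 4 / (N : ℝ))‖ₑ := by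
      rw [hA]
      refine lintegral_congr fun x => ?_
      rw [Real.enorm_rpow_of_nonneg (norm_nonneg _) (by positivity), enorm_norm]
    rw [this]
    exact hint
  have hDle : ∫⁻ x, ‖fderiv ℝ (fun y => ‖w y‖ ^ q) x‖ₑ ≤
      c * (A ^ (1 / (2 : ℝ)) * B ^ (1 / (2 : ℝ))) := by
    calc ∫⁻ x, ‖fderiv ℝ (fun y => ‖w y‖ ^ q) x‖ₑ
        ≤ ∫⁻ x, c * (‖w x‖ₑ ^ (q - 1) * ‖fderiv ℝ w x‖ₑ) := by
          refine lintegral_mono fun x => ?_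
          have h := norm_fderiv_norm_rpow_le (hw.differentiable one_ne_zero) (x := x) hq1
          have h2 : ‖fderiv ℝ (fun y => ‖w y‖ ^ q) x‖ₑ ≤
              ‖q * ‖w x‖ ^ (q - 1) * ‖fderiv ℝ w x‖‖ₑ := by
            refine enorm_le_iff_norm_le.mpr (h.trans (le_abs_self _))
          refine h2.trans (le_of_eq ?_)
          rw [enorm_mul, enorm_mul, Real.enorm_rpow_of_nonneg (norm_nonneg _) (by linarith),
            enorm_norm, enorm_norm, Real.enorm_of_nonneg (by linarith), mul_assoc]
      _ = c * ∫⁻ x, ‖w x‖ₑ ^ (q - 1) * ‖fderiv ℝ w x‖ₑ :=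
          lintegral_const_mul'' _ ((hwm.pow_const _).mul hdm)
      -- Cauchy-Schwarz. Since `2(q-1) = 2 + 4/N`, the left-hand quantity `A` reappears with power
      -- 1/2 and can be absorbed.
      _ ≤ c * (A ^ (1 / (2 : ℝ)) * B ^ (1 / (2 : ℝ))) := by
          gcongr
          have h := ENNReal.lintegral_mul_le_Lp_mul_Lq (volume : Measure (Space N))
            Real.HolderConjugate.two_two (hwm.pow_const (q - 1)) hdm
          refine h.trans (le_of_eq ?_)
          congr 2
          rw [hA]
          refine lintegral_congr fun x => ?_
          rw [← ENNReal.rpow_mul]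
          congr 1
          rw [hq]; ring
  have hmain : A ≤ K * c * W ^ (1 / (N : ℝ)) * B ^ (1 / (2 : ℝ)) * A ^ (1 / (2 : ℝ)) := by
    refine (hle w hw hwc).trans ?_
    calc K * W ^ (1 / (N : ℝ)) * ∫⁻ x, ‖fderiv ℝ (fun y => ‖w y‖ ^ q) x‖ₑ
        ≤ K * W ^ (1 / (N : ℝ)) * (c * (A ^ (1 / (2 : ℝ)) * B ^ (1 / (2 : ℝ)))) := by gcongr
      _ = _ := by ring
  rcases eq_or_ne A 0 with h0 | h0
  · rw [h0]; exact zero_le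
  have hs0 : A ^ (1 / (2 : ℝ)) ≠ 0 := by
    rw [Ne, ENNReal.rpow_eq_zero_iff]; push Not
    exact ⟨fun h => absurd h h0, fun h => absurd h hAfin⟩
  have hst : A ^ (1 / (2 : ℝ)) ≠ ⊤ := ENNReal.rpow_ne_top_of_nonneg (by norm_num) hAfin
  have hsq : A = A ^ (1 / (2 : ℝ)) * A ^ (1 / (2 : ℝ)) := by
    rw [← ENNReal.rpow_add_of_nonneg _ _ (by norm_num) (by norm_num)]; norm_num
  have hroot : A ^ (1 / (2 : ℝ)) ≤ K * c * W ^ (1 / (N : ℝ)) * B ^ (1 / (2 : ℝ)) := by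
    rw [← ENNReal.mul_le_mul_iff_left hs0 hst, ← hsq]
    exact hmain
  calc A = (A ^ (1 / (2 : ℝ))) ^ (2 : ℝ) := by rw [← ENNReal.rpow_mul]; norm_num
    _ ≤ (K * c * W ^ (1 / (N : ℝ)) * B ^ (1 / (2 : ℝ))) ^ (2 : ℝ) := by gcongr
    _ = (K * c) ^ (2 : ℝ) * W ^ (2 / (N : ℝ)) * B := by
        rw [ENNReal.mul_rpow_of_nonneg _ _ (by norm_num),
          ENNReal.mul_rpow_of_nonneg _ _ (by norm_num), ← ENNReal.rpow_mul W,
          ← ENNReal.rpow_mul B, one_div_mul_cancel (two_ne_zero), ENNReal.rpow_one]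
        congr 3
        ring

/-! ### The space W₀^{1,2}(Ω): Gagliardo-Nirenberg and the chain rule by approximation. -/

theorem eLpNorm_two_rpow_two {X F : Type*} [MeasurableSpace X] [NormedAddCommGroup F]
    (f : X → F) (μ : Measure X) : eLpNorm f 2 μ ^ (2 : ℝ) = ∫⁻ x, ‖f x‖ₑ ^ (2 : ℝ) ∂μ := by
  rw [eLpNorm_eq_lintegral_rpow_enorm_toReal two_ne_zero ENNReal.ofNat_ne_top]
  simp only [ENNReal.toReal_ofNat]
  rw [← ENNReal.rpow_mul, one_div_mul_cancel two_ne_zero, ENNReal.rpow_one]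

theorem enorm_gradient {N : ℕ} (ψ : Space N → ℝ) (x : Space N) :
    ‖gradient ψ x‖ₑ = ‖fderiv ℝ ψ x‖ₑ := by
  simp [gradient]

theorem continuous_gradient {N : ℕ} {ψ : Space N → ℝ} (h : ContDiff ℝ ∞ ψ) :
    Continuous (gradient ψ) :=
  (InnerProductSpace.toDual ℝ (Space N)).symm.continuous.comp
    (h.continuous_fderiv (by simp))

/-- The approximating sequence of a function in `W₀^{1,2}(Ω)` can be chosen to converge a.e. -/
theorem MemW012.exists_seq_tendsto_ae {N : ℕ} {Ω : Set (Space N)} {v : Space N → ℝ}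
    {Dv : Space N → Space N} (hv : MemW012 Ω v Dv) :
    ∃ ψ : ℕ → Space N → ℝ,
      (∀ j, ContDiff ℝ ∞ (ψ j) ∧ HasCompactSupport (ψ j) ∧ tsupport (ψ j) ⊆ Ω) ∧
      Tendsto (fun j => eLpNorm (fun x => ψ j x - v x) 2 (volume.restrict Ω)) atTop (𝓝 0) ∧
      Tendsto (fun j => eLpNorm (fun x => gradient (ψ j) x - Dv x) 2 (volume.restrict Ω))
        atTop (𝓝 0) ∧
      ∀ᵐ x ∂(volume.restrict Ω), Tendsto (fun j => ψ j x) atTop (𝓝 (v x)) := by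
  obtain ⟨h1, h2, ψ, hψ, hl, hg⟩ := hv
  have hm : TendstoInMeasure (volume.restrict Ω) ψ atTop v :=
    tendstoInMeasure_of_tendsto_eLpNorm two_ne_zero
      (fun j => (hψ j).1.continuous.aestronglyMeasurable) h1.1 hl
  obtain ⟨ns, hns, hae⟩ := hm.exists_seq_tendsto_ae
  exact ⟨fun j => ψ (ns j), fun j => hψ _, hl.comp hns.tendsto_atTop, hg.comp hns.tendsto_atTop,
    hae⟩

/-- The Gagliardo-Nirenberg inequality in `W₀^{1,2}(Ω)`. -/
theorem exists_lintegral_pow_le_of_memW012 (N : ℕ) (hN : 1 ≤ N) :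
    ∃ K : ℝ≥0∞, K ≠ ⊤ ∧ ∀ (Ω : Set (Space N)) (v : Space N → ℝ) (Dv : Space N → Space N),
      MemW012 Ω v Dv →
      ∫⁻ x in Ω, ‖v x‖ₑ ^ (2 + 4 / (N : ℝ)) ≤
        K * (∫⁻ x in Ω, ‖v x‖ₑ ^ (2 : ℝ)) ^ (2 / (N : ℝ)) * ∫⁻ x in Ω, ‖Dv x‖ₑ ^ (2 : ℝ) := by
  obtain ⟨K, hK, hle⟩ := exists_lintegral_pow_le N hN
  have hNpos : (0 : ℝ) < N := by exact_mod_cast hN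
  refine ⟨K, hK, fun Ω v Dv hv => ?_⟩
  obtain ⟨ψ, hψ, hl, hg, hae⟩ := hv.exists_seq_tendsto_ae
  set μ := (volume : Measure (Space N)).restrict Ω with hμ
  have hfull : ∀ (j : ℕ) (p : ℝ), 0 < p →
      ∫⁻ x, ‖ψ j x‖ₑ ^ p ∂μ = ∫⁻ x, ‖ψ j x‖ₑ ^ p := by
    intro j p hp
    refine setLIntegral_eq_of_support_subset fun x hx => ?_
    refine (hψ j).2.2 (subset_tsupport _ fun h0 => hx ?_)
    simp [h0, hp]
  have hfull' : ∀ j : ℕ, ∫⁻ x, ‖gradient (ψ j) x‖ₑ ^ (2 : ℝ) ∂μ =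
      ∫⁻ x, ‖fderiv ℝ (ψ j) x‖ₑ ^ (2 : ℝ) := by
    intro j
    simp only [enorm_gradient]
    refine setLIntegral_eq_of_support_subset fun x hx => ?_
    refine (hψ j).2.2 (support_fderiv_subset ℝ fun h0 => hx ?_)
    have hz : gradient (ψ j) x = 0 := by simp [gradient, h0]
    simp only [← enorm_gradient, hz]
    simp
  have hj : ∀ j, ∫⁻ x, ‖ψ j x‖ₑ ^ (2 + 4 / (N : ℝ)) ∂μ ≤
      K * (eLpNorm (fun x => ψ j x - v x) 2 μ + eLpNorm v 2 μ) ^ (4 / (N : ℝ)) *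
        (eLpNorm (fun x => gradient (ψ j) x - Dv x) 2 μ + eLpNorm Dv 2 μ) ^ (2 : ℝ) := by
    intro j
    have h1 := hle (ψ j) ((hψ j).1.of_le (by simp)) (hψ j).2.1
    rw [← hfull j _ (by positivity), ← hfull j _ (by positivity), ← hfull' j,
      ← eLpNorm_two_rpow_two, ← eLpNorm_two_rpow_two, ← ENNReal.rpow_mul] at h1
    refine h1.trans ?_
    have e1 : (2 : ℝ) * (2 / N) = 4 / N := by ring
    rw [e1]
    have t1 : eLpNorm (ψ j) 2 μ ≤ eLpNorm (fun x => ψ j x - v x) 2 μ + eLpNorm v 2 μ := by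
      have := eLpNorm_add_le (μ := μ) (p := 2) (f := fun x => ψ j x - v x) (g := v)
        ((hψ j).1.continuous.aestronglyMeasurable.sub hv.1.1) hv.1.1 (by norm_num)
      refine le_trans (le_of_eq ?_) this
      congr 1; ext x; simp
    have t2 : eLpNorm (gradient (ψ j)) 2 μ ≤
        eLpNorm (fun x => gradient (ψ j) x - Dv x) 2 μ + eLpNorm Dv 2 μ := by
      have := eLpNorm_add_le (μ := μ) (p := 2) (f := fun x => gradient (ψ j) x - Dv x) (g := Dv)
        ((continuous_gradient (hψ j).1).aestronglyMeasurable.sub hv.2.1.1) hv.2.1.1 (by norm_num)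
      refine le_trans (le_of_eq ?_) this
      congr 1; ext1 x; simp
    gcongr
  have hlim : Tendsto (fun j =>
      K * (eLpNorm (fun x => ψ j x - v x) 2 μ + eLpNorm v 2 μ) ^ (4 / (N : ℝ)) *
        (eLpNorm (fun x => gradient (ψ j) x - Dv x) 2 μ + eLpNorm Dv 2 μ) ^ (2 : ℝ)) atTop
      (𝓝 (K * (0 + eLpNorm v 2 μ) ^ (4 / (N : ℝ)) * (0 + eLpNorm Dv 2 μ) ^ (2 : ℝ))) := by
    have a1 := (hl.add_const (eLpNorm v 2 μ)).ennrpow_const (4 / (N : ℝ))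
    have a2 := (hg.add_const (eLpNorm Dv 2 μ)).ennrpow_const 2
    have f1 : (0 + eLpNorm v 2 μ) ^ (4 / (N : ℝ)) ≠ ⊤ := by
      rw [zero_add]; exact ENNReal.rpow_ne_top_of_nonneg (by positivity) hv.1.2.ne
    have f2 : (0 + eLpNorm Dv 2 μ) ^ (2 : ℝ) ≠ ⊤ := by
      rw [zero_add]; exact ENNReal.rpow_ne_top_of_nonneg (by positivity) hv.2.1.2.ne
    exact ENNReal.Tendsto.mul (ENNReal.Tendsto.const_mul a1 (Or.inr hK)) (Or.inr f2) a2
      (Or.inr (ENNReal.mul_ne_top hK f1))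
  have e2 : eLpNorm v 2 μ ^ (4 / (N : ℝ)) = (∫⁻ x, ‖v x‖ₑ ^ (2 : ℝ) ∂μ) ^ (2 / (N : ℝ)) := by
    rw [← eLpNorm_two_rpow_two, ← ENNReal.rpow_mul]; congr 1; ring
  rw [zero_add, zero_add, e2, eLpNorm_two_rpow_two] at hlim
  -- Fatou on the left, where only a.e. convergence of the approximants is known; the right-hand
  -- side converges with the L² norms.
  calc ∫⁻ x, ‖v x‖ₑ ^ (2 + 4 / (N : ℝ)) ∂μ
      = ∫⁻ x, liminf (fun j => ‖ψ j x‖ₑ ^ (2 + 4 / (N : ℝ))) atTop ∂μ := by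
        refine lintegral_congr_ae ?_
        filter_upwards [hae] with x hx
        exact (hx.enorm.ennrpow_const _).liminf_eq.symm
    _ ≤ liminf (fun j => ∫⁻ x, ‖ψ j x‖ₑ ^ (2 + 4 / (N : ℝ)) ∂μ) atTop :=
        lintegral_liminf_le fun j =>
          (hψ j).1.continuous.measurable.enorm.pow_const _
    _ ≤ _ := by
        rw [← hlim.liminf_eq]
        exact liminf_le_liminf (Eventually.of_forall hj)

/-- The chain rule in `W₀^{1,2}(Ω)` for smooth functions with bounded derivative. -/
theorem MemW012.comp {N : ℕ} {Ω : Set (Space N)} {v : Space N → ℝ}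
    {Dv : Space N → Space N} (hv : MemW012 Ω v Dv) {θ θ' : ℝ → ℝ} (hθ : ContDiff ℝ ∞ θ)
    (hd : ∀ s, HasDerivAt θ (θ' s) s) (h0 : θ 0 = 0) {K : ℝ} (hK : ∀ s, |θ' s| ≤ K) :
    MemW012 Ω (fun x => θ (v x)) (fun x => θ' (v x) • Dv x) := by
  obtain ⟨ψ, hψ, hl, hg, hae⟩ := hv.exists_seq_tendsto_ae
  set μ := (volume : Measure (Space N)).restrict Ω with hμ
  have hK0 : 0 ≤ K := (abs_nonneg _).trans (hK 0)
  have hlip : ∀ a b, |θ a - θ b| ≤ K * |a - b| := fun a b => by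
    have := convex_univ.norm_image_sub_le_of_norm_hasDerivWithin_le (f := θ) (f' := θ') (C := K)
      (fun x _ => (hd x).hasDerivWithinAt) (fun x _ => hK x) (mem_univ b) (mem_univ a)
    simpa using this
  have hθ'c : Continuous θ' := by
    have : θ' = deriv θ := funext fun s => (hd s).deriv.symm
    rw [this]; exact hθ.continuous_deriv (by simp)
  have hθ'm : AEStronglyMeasurable (fun x => θ' (v x)) μ :=
    hθ'c.comp_aestronglyMeasurable hv.1.1
  have hgrad : ∀ j x, gradient (fun y => θ (ψ j y)) x = θ' (ψ j x) • gradient (ψ j) x := by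
    intro j x
    have h1 : HasFDerivAt (ψ j) (fderiv ℝ (ψ j) x) x :=
      ((hψ j).1.differentiable (by simp) x).hasFDerivAt
    have h2 := (hd (ψ j x)).comp_hasFDerivAt x h1
    have h3 : fderiv ℝ (fun y => θ (ψ j y)) x = θ' (ψ j x) • fderiv ℝ (ψ j) x := h2.fderiv
    simp only [gradient, h3, map_smulₛₗ]
    simp
  refine ⟨?_, ?_, fun j x => θ (ψ j x), fun j => ⟨hθ.comp (hψ j).1, ?_, ?_⟩, ?_, ?_⟩
  · refine hv.1.of_le_mul (c := K) (hθ.continuous.comp_aestronglyMeasurable hv.1.1)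
      (Eventually.of_forall fun x => ?_)
    simpa [h0] using hlip (v x) 0
  · refine hv.2.1.of_le_mul (c := K) (hθ'm.smul hv.2.1.1) (Eventually.of_forall fun x => ?_)
    rw [norm_smul]
    exact mul_le_mul_of_nonneg_right (hK _) (norm_nonneg _)
  · exact (hψ j).2.1.comp_left h0
  · refine (closure_mono ?_).trans (hψ j).2.2
    intro x hx h
    exact hx (by simp [h, h0])
  · have hc : Tendsto (fun j => ENNReal.ofReal K * eLpNorm (fun x => ψ j x - v x) 2 μ) atTop
        (𝓝 (ENNReal.ofReal K * 0)) := ENNReal.Tendsto.const_mul hl (Or.inr ENNReal.ofReal_ne_top)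
    rw [mul_zero] at hc
    refine tendsto_of_tendsto_of_tendsto_of_le_of_le tendsto_const_nhds hc (fun _ => zero_le)
      fun j => ?_
    exact eLpNorm_le_mul_eLpNorm_of_ae_le_mul (Eventually.of_forall fun x => hlip _ _) 2
  · have hc : Tendsto (fun j => ENNReal.ofReal K *
        eLpNorm (fun x => gradient (ψ j) x - Dv x) 2 μ) atTop
        (𝓝 (ENNReal.ofReal K * 0)) := ENNReal.Tendsto.const_mul hg (Or.inr ENNReal.ofReal_ne_top)
    rw [mul_zero] at hc
    -- The gradient error splits into `θ'(ψ_j)(∇ψ_j - Dv)`, bounded by `K` times an L² error, and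
    -- `(θ'(ψ_j) - θ'(v)) Dv`, treated here by dominated convergence along the a.e. convergent
    -- sequence.
    have hdom : Tendsto (fun j => eLpNorm (fun x => (θ' (ψ j x) - θ' (v x)) • Dv x) 2 μ) atTop
        (𝓝 0) := by
      have h2 : Tendsto (fun j => ∫⁻ x, ‖(θ' (ψ j x) - θ' (v x)) • Dv x‖ₑ ^ (2 : ℝ) ∂μ) atTop
          (𝓝 (∫⁻ _, 0 ∂μ)) := by
        refine tendsto_lintegral_of_dominated_convergence'
          (fun x => (ENNReal.ofReal (2 * K) * ‖Dv x‖ₑ) ^ (2 : ℝ)) (fun j => ?_)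
          (fun j => Eventually.of_forall fun x => ?_) ?_ ?_
        · exact ((((hθ'c.comp (hψ j).1.continuous).aestronglyMeasurable.sub hθ'm).smul
            hv.2.1.1).enorm).pow_const _
        · beta_reduce
          rw [enorm_smul]
          gcongr
          rw [Real.enorm_eq_ofReal_abs]
          refine ENNReal.ofReal_le_ofReal ?_
          calc |θ' (ψ j x) - θ' (v x)| ≤ |θ' (ψ j x)| + |θ' (v x)| := abs_sub _ _
            _ ≤ 2 * K := by linarith [hK (ψ j x), hK (v x)]
        · have : ∀ x, (ENNReal.ofReal (2 * K) * ‖Dv x‖ₑ) ^ (2 : ℝ) =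
              ENNReal.ofReal (2 * K) ^ (2 : ℝ) * ‖Dv x‖ₑ ^ (2 : ℝ) := fun x =>
            ENNReal.mul_rpow_of_nonneg _ _ (by norm_num)
          simp only [this]
          rw [lintegral_const_mul'' _ (hv.2.1.1.enorm.pow_const _), ← eLpNorm_two_rpow_two]
          exact ENNReal.mul_ne_top (ENNReal.rpow_ne_top_of_nonneg (by norm_num)
            ENNReal.ofReal_ne_top) (ENNReal.rpow_ne_top_of_nonneg (by norm_num) hv.2.1.2.ne)
        · filter_upwards [hae] with x hx
          have h3 : Tendsto (fun j => (θ' (ψ j x) - θ' (v x)) • Dv x) atTop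
              (𝓝 ((θ' (v x) - θ' (v x)) • Dv x)) :=
            (((hθ'c.tendsto _).comp hx).sub_const _).smul_const _
          have h4 := (h3.enorm).ennrpow_const (2 : ℝ)
          simpa using h4
      rw [lintegral_zero] at h2
      have h5 := h2.ennrpow_const (1 / (2 : ℝ))
      simp only [← eLpNorm_two_rpow_two, ← ENNReal.rpow_mul, mul_one_div_cancel (two_ne_zero' ℝ),
        ENNReal.rpow_one] at h5
      simpa using h5
    have hsum := hc.add hdom
    rw [add_zero] at hsum
    refine tendsto_of_tendsto_of_tendsto_of_le_of_le tendsto_const_nhds hsum (fun _ => zero_le)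
      fun j => ?_
    have hgm : AEStronglyMeasurable (fun x => gradient (ψ j) x - Dv x) μ :=
      (continuous_gradient (hψ j).1).aestronglyMeasurable.sub hv.2.1.1
    have hψ'm : AEStronglyMeasurable (fun x => θ' (ψ j x)) μ :=
      (hθ'c.comp (hψ j).1.continuous).aestronglyMeasurable
    calc eLpNorm (fun x => gradient (fun y => θ (ψ j y)) x - θ' (v x) • Dv x) 2 μ
        = eLpNorm ((fun x => θ' (ψ j x) • (gradient (ψ j) x - Dv x)) +
            fun x => (θ' (ψ j x) - θ' (v x)) • Dv x) 2 μ := by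
          congr 1; ext1 x
          simp only [hgrad, Pi.add_apply, smul_sub, sub_smul]
          abel
      _ ≤ eLpNorm (fun x => θ' (ψ j x) • (gradient (ψ j) x - Dv x)) 2 μ +
            eLpNorm (fun x => (θ' (ψ j x) - θ' (v x)) • Dv x) 2 μ :=
          eLpNorm_add_le (hψ'm.smul hgm) ((hψ'm.sub hθ'm).smul hv.2.1.1) (by norm_num)
      _ ≤ _ := by
          gcongr
          refine eLpNorm_le_mul_eLpNorm_of_ae_le_mul (Eventually.of_forall fun x => ?_) 2
          rw [norm_smul]
          exact mul_le_mul_of_nonneg_right (hK _) (norm_nonneg _)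

/-! ### The weight `η` and the functions `G`, `ψ`, `Ψ` built from it. -/

theorem le_of_hasDerivAt_sign {g g' : ℝ → ℝ} {c : ℝ} (hd : ∀ s, HasDerivAt g (g' s) s)
    (hneg : ∀ s ≤ c, g' s ≤ 0) (hpos : ∀ s, c ≤ s → 0 ≤ g' s) (b : ℝ) : g c ≤ g b := by
  have hc : Continuous g := continuous_iff_continuousAt.2 fun s => (hd s).continuousAt
  rcases le_total b c with h | h
  · refine antitoneOn_of_deriv_nonpos (convex_Iic c) hc.continuousOn
      (fun s _ => (hd s).differentiableAt.differentiableWithinAt) (fun s hs => ?_) h self_mem_Iic h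
    rw [(hd s).deriv]
    exact hneg s (show s ∈ Iic c from interior_subset hs)
  · refine monotoneOn_of_deriv_nonneg (convex_Ici c) hc.continuousOn
      (fun s _ => (hd s).differentiableAt.differentiableWithinAt) (fun s hs => ?_) self_mem_Ici h h
    rw [(hd s).deriv]
    exact hpos s (show s ∈ Ici c from interior_subset hs)

/-- A convex function lies above its tangent at `a`. This inequality takes the place of the chain
rule in time. -/
theorem sub_le_mul_sub_of_monotone_deriv {Ψ ψ : ℝ → ℝ} (hd : ∀ s, HasDerivAt Ψ (ψ s) s)
    (hm : Monotone ψ) (a b : ℝ) : Ψ a - Ψ b ≤ ψ a * (a - b) := by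
  have h := le_of_hasDerivAt_sign (g := fun s => Ψ s - ψ a * s) (g' := fun s => ψ s - ψ a) (c := a)
    (fun s => by
      have := (hd s).sub ((hasDerivAt_id s).const_mul (ψ a))
      rw [mul_one] at this
      exact this)
    (fun s hs => sub_nonpos.2 (hm hs)) (fun s hs => sub_nonneg.2 (hm hs)) b
  linarith

/-- For a positive function decaying like `1/(1+s)`, the product of its primitive and itself is
controlled by the primitive of its square. -/
theorem exists_integral_mul_le {η : ℝ → ℝ} (hc : Continuous η) (hpos : ∀ s, 0 < η s)
    (h1 : ∀ s, η s ≤ 1) {C : ℝ} (hC : ∀ s, η s * (1 + |s|) ≤ C) :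
    ∃ K, 0 ≤ K ∧ ∀ r, 0 ≤ r → (∫ s in (0 : ℝ)..r, η s) * η r ≤ K * ∫ s in (0 : ℝ)..r, η s ^ 2 := by
  obtain ⟨x₀, -, hx₀⟩ := (isCompact_Icc (a := (0 : ℝ)) (b := 1)).exists_isMinOn
    (nonempty_Icc.2 zero_le_one) hc.continuousOn
  set m := η x₀ ^ 2 with hm
  have hm0 : 0 < m := pow_pos (hpos _) 2
  have hmle : ∀ s ∈ Icc (0 : ℝ) 1, m ≤ η s ^ 2 := fun s hs =>
    pow_le_pow_left₀ (hpos _).le (hx₀ hs) 2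
  have hC0 : 0 ≤ C := by
    have := hC 0
    have h' := hpos 0
    simp at this
    linarith
  have hGr : ∀ r, 0 ≤ r → (∫ s in (0 : ℝ)..r, η s) ≤ r := fun r hr => by
    have := intervalIntegral.integral_mono_on (μ := volume) hr (hc.intervalIntegrable 0 r)
      (continuous_const.intervalIntegrable 0 r) (g := fun _ => (1 : ℝ)) (fun s _ => h1 s)
    simpa using this
  have hlow : ∀ r, 0 ≤ r → r ≤ 1 → r * m ≤ ∫ s in (0 : ℝ)..r, η s ^ 2 := fun r hr hr1 => by
    have := intervalIntegral.integral_mono_on (μ := volume) hr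
      ((continuous_const (y := m)).intervalIntegrable 0 r)
      ((hc.pow 2).intervalIntegrable 0 r)
      (fun s hs => hmle s ⟨hs.1, hs.2.trans hr1⟩)
    simpa using this
  have hc2 : Continuous fun s => η s ^ 2 := hc.pow 2
  refine ⟨(1 + C) / m, by positivity, fun r hr => ?_⟩
  have hG0 : 0 ≤ ∫ s in (0 : ℝ)..r, η s :=
    intervalIntegral.integral_nonneg hr fun s _ => (hpos s).le
  rw [div_mul_eq_mul_div, le_div_iff₀ hm0]
  -- For `r ≤ 1` the product is at most `r` and the integral of the square at least `r m`. For `r ≥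
  -- 1` the decay of `η` keeps the product below `C`, while the integral is at least its value at 1,
  -- hence at least `m`.
  rcases le_total r 1 with hr1 | hr1
  · have e1 := hlow r hr hr1
    have e2 : (∫ s in (0 : ℝ)..r, η s) * η r ≤ r * 1 :=
      mul_le_mul (hGr r hr) (h1 r) (hpos r).le hr
    have e3 : 0 ≤ ∫ s in (0 : ℝ)..r, η s ^ 2 :=
      intervalIntegral.integral_nonneg hr fun s _ => sq_nonneg _
    nlinarith
  · have e1 := hlow 1 zero_le_one le_rfl
    have e2 : (∫ s in (0 : ℝ)..r, η s) * η r ≤ C := by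
      refine (mul_le_mul_of_nonneg_right (hGr r hr) (hpos r).le).trans ?_
      have := hC r
      rw [abs_of_nonneg hr] at this
      nlinarith [hpos r]
    have e3 : (∫ s in (0 : ℝ)..1, η s ^ 2) ≤ ∫ s in (0 : ℝ)..r, η s ^ 2 := by
      rw [← intervalIntegral.integral_add_adjacent_intervals
        (hc2.intervalIntegrable 0 1) (hc2.intervalIntegrable 1 r)]
      have := intervalIntegral.integral_nonneg (μ := volume) hr1 (f := fun s => η s ^ 2)
        fun s _ => sq_nonneg _
      linarith
    calc _ ≤ C * m := mul_le_mul_of_nonneg_right e2 hm0.le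
      _ ≤ (1 + C) * ∫ s in (0 : ℝ)..r, η s ^ 2 := by nlinarith

/-- At each point half of `1/(|h|+1)` lies strictly between its quarter and itself, and by
continuity this constant remains admissible nearby; a partition of unity glues these local choices.
Smoothness matters because composition must keep the approximants in C_c^∞. -/
theorem exists_smooth_weight {h : ℝ → ℝ} (hc : Continuous h) :
    ∃ η : ℝ → ℝ, ContDiff ℝ ∞ η ∧ (∀ s, 0 < η s) ∧ (∀ s, η s * (|h s| + 1) ≤ 1) ∧
      ∀ s, 1 / (|h s| + 1) ≤ 4 * η s := by
  have hp : ∀ s, 0 < |h s| + 1 := fun s => by positivity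
  have hcont : Continuous fun s => 1 / (|h s| + 1) :=
    continuous_const.div (hc.abs.add continuous_const) fun s => (hp s).ne'
  obtain ⟨η, hη⟩ := exists_contMDiffMap_forall_mem_convex_of_local_const (n := ⊤)
    (modelWithCornersSelf ℝ ℝ)
    (t := fun s : ℝ => Ioo ((1 / (|h s| + 1)) / 4) (1 / (|h s| + 1)))
    (fun s => convex_Ioo _ _) (fun s => ⟨(1 / (|h s| + 1)) / 2, by
      have h0 : 0 < 1 / (|h s| + 1) := one_div_pos.2 (hp s)
      have e1 : ∀ᶠ y in 𝓝 s, (1 / (|h y| + 1)) / 4 < (1 / (|h s| + 1)) / 2 :=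
        (hcont.div_const 4).continuousAt.eventually_lt continuousAt_const (by linarith)
      have e2 : ∀ᶠ y in 𝓝 s, (1 / (|h s| + 1)) / 2 < 1 / (|h y| + 1) :=
        continuousAt_const.eventually_lt hcont.continuousAt (by linarith)
      exact e1.and e2⟩)
  refine ⟨η, η.contMDiff.contDiff, fun s => ?_, fun s => ?_, fun s => ?_⟩
  · exact lt_trans (by have := hp s; positivity) (hη s).1
  · have := (hη s).2.le
    rwa [le_div_iff₀ (hp s)] at this
  · linarith [(hη s).1]

/-- The auxiliary functions: `G` is comparable to `H`, `ψ` is the bounded function whose composition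
with the solution is the test function, and `Ψ` is the primitive of `ψ`. -/
theorem exists_auxiliary_functions {h : ℝ → ℝ} (hc : Continuous h)
    (hsuper : Tendsto (fun l : ℝ => |h l| / |l|) (cocompact ℝ) atTop) :
    ∃ (η G ψ Ψ : ℝ → ℝ) (B K : ℝ), ContDiff ℝ ∞ G ∧ ContDiff ℝ ∞ ψ ∧
      (∀ s, HasDerivAt G (η s) s) ∧ (∀ s, HasDerivAt ψ (η s ^ 2) s) ∧
      (∀ s, HasDerivAt Ψ (ψ s) s) ∧ G 0 = 0 ∧ ψ 0 = 0 ∧ Ψ 0 = 0 ∧ (∀ s, 0 < η s) ∧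
      (∀ s, η s * (|h s| + 1) ≤ 1) ∧ (∀ s, |ψ s| ≤ B) ∧ 0 ≤ K ∧ (∀ s, G s ^ 2 ≤ K * Ψ s) ∧
      ∀ s, |Hfun h s| ≤ 4 * |G s| := by
  obtain ⟨η, hη, hpos, hle, hge⟩ := exists_smooth_weight hc
  have hηc := hη.continuous
  have hp : ∀ s, 0 < |h s| + 1 := fun s => by positivity
  have h1 : ∀ s, η s ≤ 1 := fun s => by nlinarith [hle s, hpos s, abs_nonneg (h s)]
  -- decay of `η`
  obtain ⟨C, hC⟩ : ∃ C, ∀ s, η s * (1 + |s|) ≤ C := by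
    have he : ∀ᶠ l in cocompact ℝ, 1 ≤ |h l| / |l| := hsuper.eventually_ge_atTop 1
    obtain ⟨R, hR⟩ := (hasBasis_cocompact.eventually_iff.1 he).imp
      fun S hS => hS
    obtain ⟨R', hR'⟩ := hR.1.isBounded.exists_norm_le
    have hR0 : 0 ≤ max R' 0 := le_max_right _ _
    refine ⟨1 + max R' 0, fun s => ?_⟩
    by_cases hs : s ∈ R
    · have e1 : |s| ≤ max R' 0 := (hR' s hs).trans (le_max_left _ _)
      nlinarith [h1 s, hpos s, abs_nonneg s]
    · have e1 := hR.2 hs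
      have e2 : |s| ≤ |h s| := by
        rcases eq_or_ne s 0 with rfl | h0
        · simp
        · rwa [one_le_div (abs_pos.2 h0)] at e1
      nlinarith [hle s, hpos s]
  have hdG : ∀ s, HasDerivAt (fun r => ∫ t in (0 : ℝ)..r, η t) (η s) s := fun s =>
    intervalIntegral.integral_hasDerivAt_right (hηc.intervalIntegrable _ _)
      (hηc.stronglyMeasurableAtFilter _ _) hηc.continuousAt
  have hη2 : Continuous fun s => η s ^ 2 := hηc.pow 2
  have hdψ : ∀ s, HasDerivAt (fun r => ∫ t in (0 : ℝ)..r, η t ^ 2) (η s ^ 2) s := fun s =>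
    intervalIntegral.integral_hasDerivAt_right (hη2.intervalIntegrable _ _)
      (hη2.stronglyMeasurableAtFilter _ _) hη2.continuousAt
  set G : ℝ → ℝ := fun r => ∫ t in (0 : ℝ)..r, η t with hG
  set ψ : ℝ → ℝ := fun r => ∫ t in (0 : ℝ)..r, η t ^ 2 with hψ
  have hψc : Continuous ψ := continuous_iff_continuousAt.2 fun s => (hdψ s).continuousAt
  have hdΨ : ∀ s, HasDerivAt (fun r => ∫ t in (0 : ℝ)..r, ψ t) (ψ s) s := fun s =>
    intervalIntegral.integral_hasDerivAt_right (hψc.intervalIntegrable _ _)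
      (hψc.stronglyMeasurableAtFilter _ _) hψc.continuousAt
  have hsm : ∀ {F F' : ℝ → ℝ}, (∀ s, HasDerivAt F (F' s) s) → ContDiff ℝ ∞ F' →
      ContDiff ℝ ∞ F := fun {F F'} hF hF' => by
    rw [contDiff_infty_iff_deriv]
    refine ⟨fun s => (hF s).differentiableAt, ?_⟩
    rwa [show deriv F = F' from funext fun s => (hF s).deriv]
  -- The decay gives `η² ≤ C²/(1+t²)`, whose integral over the whole line bounds `ψ`. This is where
  -- superlinear growth makes an L¹ source admissible.
  have hbd : ∀ s, |ψ s| ≤ C ^ 2 * ∫ t : ℝ, (1 + t ^ 2)⁻¹ := fun s => by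
    have e := intervalIntegral.norm_integral_le_integral_norm_uIoc (f := fun t => η t ^ 2)
      (a := 0) (b := s) (μ := volume)
    refine e.trans ?_
    rw [← integral_const_mul]
    have hint : Integrable (fun t : ℝ => C ^ 2 * (1 + t ^ 2)⁻¹) :=
      integrable_inv_one_add_sq.const_mul _
    refine (setIntegral_mono_on ((hη2.norm.integrableOn_uIcc).mono_set uIoc_subset_uIcc)
      hint.integrableOn measurableSet_uIoc fun t _ => ?_).trans
      (setIntegral_le_integral hint (Eventually.of_forall fun t => by positivity))
    rw [Real.norm_of_nonneg (sq_nonneg _), ← div_eq_mul_inv, le_div_iff₀ (by positivity)]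
    have a1 : 0 ≤ η t * (1 + |t|) := mul_nonneg (hpos t).le (by positivity)
    have a2 := pow_le_pow_left₀ a1 (hC t) 2
    have a3 : 1 + t ^ 2 ≤ (1 + |t|) ^ 2 := by nlinarith [abs_nonneg t, sq_abs t]
    calc η t ^ 2 * (1 + t ^ 2) ≤ η t ^ 2 * (1 + |t|) ^ 2 := by gcongr
      _ ≤ C ^ 2 := by rw [← mul_pow]; exact a2
  obtain ⟨K₁, hK₁, hK₁'⟩ := exists_integral_mul_le hηc hpos h1 hC
  obtain ⟨K₂, hK₂, hK₂'⟩ := exists_integral_mul_le (η := fun s => η (-s))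
    (hηc.comp continuous_neg) (fun s => hpos _) (fun s => h1 _) (C := C)
    (fun s => by simpa using hC (-s))
  have hψpos : ∀ s, 0 ≤ s → 0 ≤ ψ s := fun s hs =>
    intervalIntegral.integral_nonneg hs fun t _ => sq_nonneg _
  have hψneg : ∀ s, s ≤ 0 → ψ s ≤ 0 := fun s hs => by
    have := intervalIntegral.integral_nonneg (μ := volume) hs (f := fun s => η s ^ 2)
      fun s _ => sq_nonneg _
    rw [intervalIntegral.integral_symm] at this
    simp only [hψ]; linarith
  refine ⟨η, G, ψ, fun r => ∫ t in (0 : ℝ)..r, ψ t, C ^ 2 * ∫ t : ℝ, (1 + t ^ 2)⁻¹,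
    2 * (K₁ + K₂), hsm hdG hη, hsm hdψ (hη.pow 2), hdG, hdψ, hdΨ, by simp [hG], by simp [hψ],
    by simp, hpos, hle, hbd, by positivity, fun s => ?_, fun s => ?_⟩
  -- The function `2(K₁+K₂) Ψ - G²` vanishes at 0 and has its minimum there, because `|G| η ≤
  -- (K₁+K₂)|ψ|`: `K₁` serves the positive half-line and `K₂`, obtained from the reflected weight,
  -- the negative one.
  · have key := le_of_hasDerivAt_sign (c := 0)
      (g := fun s => 2 * (K₁ + K₂) * (∫ t in (0 : ℝ)..s, ψ t) - G s ^ 2)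
      (g' := fun s => 2 * (K₁ + K₂) * ψ s - 2 * G s * η s)
      (fun s => by
        have := ((hdΨ s).const_mul (2 * (K₁ + K₂))).sub ((hdG s).pow 2)
        simp only [Nat.cast_ofNat, Nat.add_one_sub_one, pow_one] at this
        exact this)
      (fun s hs => ?_) (fun s hs => ?_) s
    · simp only [intervalIntegral.integral_same, hG] at key
      simp only [hG]
      norm_num at key
      linarith
    · have e := hK₂' (-s) (by linarith)
      rw [intervalIntegral.integral_comp_neg (fun t => η t),
        intervalIntegral.integral_comp_neg (fun t => η t ^ 2), neg_neg, neg_zero,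
        intervalIntegral.integral_symm 0 s, intervalIntegral.integral_symm 0 s] at e
      change -G s * η s ≤ K₂ * -ψ s at e
      nlinarith [hψneg s hs]
    · have e := hK₁' s hs
      change G s * η s ≤ K₁ * ψ s at e
      nlinarith [hψpos s hs]
  · have hcH : Continuous fun s => 1 / (|h s| + 1) :=
      continuous_const.div (hc.abs.add continuous_const) fun s => (hp s).ne'
    have hmono : ∀ a b : ℝ, a ≤ b → 0 ≤ ∫ l in a..b, 1 / (|h l| + 1) ∧
        ∫ l in a..b, 1 / (|h l| + 1) ≤ 4 * ∫ l in a..b, η l := fun a b hab => by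
      refine ⟨intervalIntegral.integral_nonneg hab fun t _ => by have := hp t; positivity, ?_⟩
      rw [← intervalIntegral.integral_const_mul]
      exact intervalIntegral.integral_mono_on hab (hcH.intervalIntegrable _ _)
        ((continuous_const.mul hηc).intervalIntegrable _ _) fun t _ => hge t
    simp only [Hfun, hG]
    rcases le_total 0 s with hs | hs
    · obtain ⟨e1, e2⟩ := hmono 0 s hs
      rw [abs_of_nonneg e1]
      exact e2.trans (mul_le_mul_of_nonneg_left (le_abs_self _) (by norm_num))
    · obtain ⟨e1, e2⟩ := hmono s 0 hs
      rw [intervalIntegral.integral_symm s 0, abs_neg, abs_of_nonneg e1,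
        intervalIntegral.integral_symm s 0, abs_neg]
      exact e2.trans (mul_le_mul_of_nonneg_left (le_abs_self _) (by norm_num))

/-! ### Weak derivatives of functions of time. -/

theorem deriv_smoothTransition_eq_zero {y : ℝ} (hy : y ∉ Icc (0 : ℝ) 1) :
    deriv Real.smoothTransition y = 0 := by
  rcases lt_or_ge y 0 with h | h
  · have : Real.smoothTransition =ᶠ[𝓝 y] fun _ => 0 := by
      filter_upwards [Iio_mem_nhds h] with z hz
      exact Real.smoothTransition.zero_of_nonpos hz.le
    rw [this.deriv_eq, deriv_const]
  · have h1 : 1 < y := by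
      by_contra h1
      exact hy ⟨h, not_lt.1 h1⟩
    have : Real.smoothTransition =ᶠ[𝓝 y] fun _ => 1 := by
      filter_upwards [Ioi_mem_nhds h1] with z hz
      exact Real.smoothTransition.one_of_one_le (le_of_lt hz)
    rw [this.deriv_eq, deriv_const]

theorem contDiff_smoothTransition : ContDiff ℝ ∞ Real.smoothTransition :=
  Real.smoothTransition.contDiff (n := ⊤)

/-- Rescaled derivatives of the smooth transition function form an approximate identity. -/
theorem tendsto_integral_mul_deriv_smoothTransition {b : ℝ → ℝ} (hb : Continuous b) (s : ℝ) :
    Tendsto (fun ε : ℝ => ∫ σ, b σ * (ε⁻¹ * deriv Real.smoothTransition ((σ - s) / ε)))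
      (𝓝[>] 0) (𝓝 (b s)) := by
  have hS := contDiff_smoothTransition
  have hS' : Continuous (deriv Real.smoothTransition) := hS.continuous_deriv (by simp)
  have h1 : ∀ ε : ℝ, 0 < ε → ∫ σ, b σ * (ε⁻¹ * deriv Real.smoothTransition ((σ - s) / ε)) =
      ∫ y in (0 : ℝ)..1, b (s + ε * y) * deriv Real.smoothTransition y := by
    intro ε hε
    set F : ℝ → ℝ := fun y => b (s + ε * y) * deriv Real.smoothTransition y with hF
    have e1 : ∀ σ, b σ * (ε⁻¹ * deriv Real.smoothTransition ((σ - s) / ε)) =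
        ε⁻¹ * F ((σ - s) / ε) := by
      intro σ
      have : s + ε * ((σ - s) / ε) = σ := by field_simp; ring
      simp only [hF, this]; ring
    simp only [e1]
    rw [integral_const_mul, integral_sub_right_eq_self (fun σ => F (σ / ε)) s,
      Measure.integral_comp_div, abs_of_pos hε, smul_eq_mul, inv_mul_cancel_left₀ hε.ne',
      intervalIntegral.integral_of_le zero_le_one, ← integral_Icc_eq_integral_Ioc]
    refine (setIntegral_eq_integral_of_forall_compl_eq_zero fun y hy => ?_).symm
    simp only [hF, deriv_smoothTransition_eq_zero hy, mul_zero]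
  have h2 : Continuous fun ε : ℝ => ∫ y in (0 : ℝ)..1, b (s + ε * y) *
      deriv Real.smoothTransition y := by
    refine intervalIntegral.continuous_parametric_intervalIntegral_of_continuous' ?_ 0 1
    fun_prop
  have h3 : ∫ y in (0 : ℝ)..1, b (s + 0 * y) * deriv Real.smoothTransition y = b s := by
    simp only [zero_mul, add_zero]
    rw [intervalIntegral.integral_const_mul,
      intervalIntegral.integral_deriv_eq_sub (fun x _ => hS.differentiable (by simp) x)
        (hS'.intervalIntegrable _ _)]
    simp
  have h4 := (h2.tendsto 0).mono_left (nhdsWithin_le_nhds (s := Ioi 0))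
  rw [h3] at h4
  refine h4.congr' ?_
  filter_upwards [self_mem_nhdsWithin] with ε hε
  exact (h1 ε hε).symm

/-- A continuous function with integrable weak derivative is the integral of the latter. -/
theorem sub_eq_integral_of_weak_deriv {T : ℝ} {a b : ℝ → ℝ} (hb : Continuous b)
    (ha : IntegrableOn a (Ioo 0 T))
    (hw : ∀ ρ : ℝ → ℝ, ContDiff ℝ ∞ ρ → HasCompactSupport ρ → tsupport ρ ⊆ Ioo 0 T →
      -∫ σ in Ioo 0 T, b σ * deriv ρ σ = ∫ σ in Ioo 0 T, a σ * ρ σ)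
    {s t : ℝ} (hs : 0 < s) (hst : s ≤ t) (ht : t < T) :
    b t - b s = ∫ σ in s..t, a σ := by
  have hS := contDiff_smoothTransition
  -- A smooth plateau tending to the indicator of `(s,t]`. Its derivative is the difference of two
  -- approximate identities at `s` and `t`. Its support lies in `[s,t+ε]`, inside `(0,T)` for small
  -- `ε` because `0 < s` and `t < T`.
  set ρ : ℝ → ℝ → ℝ := fun ε σ =>
    Real.smoothTransition ((σ - s) / ε) - Real.smoothTransition ((σ - t) / ε) with hρ
  have hρd : ∀ ε σ, HasDerivAt (ρ ε) (ε⁻¹ * deriv Real.smoothTransition ((σ - s) / ε) -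
      ε⁻¹ * deriv Real.smoothTransition ((σ - t) / ε)) σ := by
    intro ε σ
    have key : ∀ c, HasDerivAt (fun σ => Real.smoothTransition ((σ - c) / ε))
        (ε⁻¹ * deriv Real.smoothTransition ((σ - c) / ε)) σ := fun c => by
      have e1 : HasDerivAt (fun σ => (σ - c) / ε) (1 / ε) σ :=
        ((hasDerivAt_id σ).sub_const c).div_const ε
      have e2 : HasDerivAt Real.smoothTransition (deriv Real.smoothTransition ((σ - c) / ε))
          ((σ - c) / ε) := (hS.differentiable (by simp) _).hasDerivAt
      have e3 := e2.comp σ e1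
      rw [one_div, mul_comm] at e3
      exact e3
    exact (key s).sub (key t)
  have hρs : ∀ ε, ContDiff ℝ ∞ (ρ ε) := fun ε =>
    (hS.comp ((contDiff_id.sub contDiff_const).div_const ε)).sub
      (hS.comp ((contDiff_id.sub contDiff_const).div_const ε))
  have hρsupp : ∀ ε, 0 < ε → tsupport (ρ ε) ⊆ Icc s (t + ε) := by
    intro ε hε
    refine closure_minimal (fun σ hσ => ?_) isClosed_Icc
    by_contra hn
    apply hσ
    rcases lt_or_ge σ s with h | h
    · simp only [hρ]
      rw [Real.smoothTransition.zero_of_nonpos (div_nonpos_of_nonpos_of_nonneg (by linarith) hε.le),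
        Real.smoothTransition.zero_of_nonpos (div_nonpos_of_nonpos_of_nonneg (by linarith) hε.le),
        sub_zero]
    · have h2 : t + ε < σ := by
        by_contra h2
        exact hn ⟨h, not_lt.1 h2⟩
      simp only [hρ]
      rw [Real.smoothTransition.one_of_one_le ((one_le_div hε).2 (by linarith)),
        Real.smoothTransition.one_of_one_le ((one_le_div hε).2 (by linarith)), sub_self]
  have hev : ∀ᶠ ε : ℝ in 𝓝[>] 0, 0 < ε ∧ t + ε < T := by
    have : ∀ᶠ ε : ℝ in 𝓝[>] 0, ε < T - t :=
      nhdsWithin_le_nhds (Iio_mem_nhds (by linarith))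
    filter_upwards [self_mem_nhdsWithin, this] with ε h1 h2
    exact ⟨h1, by linarith⟩
  -- the left-hand side
  have hL : Tendsto (fun ε => -∫ σ in Ioo 0 T, b σ * deriv (ρ ε) σ) (𝓝[>] 0)
      (𝓝 (b t - b s)) := by
    have h1 := (tendsto_integral_mul_deriv_smoothTransition hb t).sub
      (tendsto_integral_mul_deriv_smoothTransition hb s)
    refine h1.congr' ?_
    filter_upwards [hev] with ε hε
    have hint : ∀ c, Integrable fun σ =>
        b σ * (ε⁻¹ * deriv Real.smoothTransition ((σ - c) / ε)) := fun c => by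
      refine Continuous.integrable_of_hasCompactSupport ?_ ?_
      · have := hS.continuous_deriv (by simp)
        fun_prop
      · refine HasCompactSupport.of_support_subset_isCompact (isCompact_Icc (a := c) (b := c + ε))
          fun σ hσ => ?_
        by_contra hn
        refine hσ ?_
        have : (σ - c) / ε ∉ Icc (0 : ℝ) 1 := fun hh => hn ⟨?_, ?_⟩
        · simp only [deriv_smoothTransition_eq_zero this, mul_zero]
        · have := (div_nonneg_iff.1 hh.1)
          rcases this with h | h <;> linarith [h.1, h.2, hε.1]
        · have := (div_le_one hε.1).1 hh.2
          linarith
    rw [setIntegral_eq_integral_of_forall_compl_eq_zero (fun σ hσ => ?_), ← integral_sub (hint t)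
      (hint s), ← integral_neg]
    · refine integral_congr_ae (Eventually.of_forall fun σ => ?_)
      simp only [(hρd ε σ).deriv]
      ring
    · have : σ ∉ tsupport (deriv (ρ ε)) := fun h => hσ (by
        have h2 := hρsupp ε hε.1 (tsupport_deriv_subset (f := ρ ε) h)
        exact ⟨by linarith [h2.1], by linarith [h2.2, hε.2]⟩)
      rw [image_eq_zero_of_notMem_tsupport this, mul_zero]
  have hR : Tendsto (fun ε => ∫ σ in Ioo 0 T, a σ * ρ ε σ) (𝓝[>] 0)
      (𝓝 (∫ σ in Ioo 0 T, (Ioc s t).indicator a σ)) := by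
    refine tendsto_integral_filter_of_dominated_convergence (fun σ => ‖a σ‖)
      (Eventually.of_forall fun ε =>
        ha.aestronglyMeasurable.mul (hρs ε).continuous.aestronglyMeasurable)
      (Eventually.of_forall fun ε => Eventually.of_forall fun σ => ?_) ha.norm
      (Eventually.of_forall fun σ => ?_)
    · rw [norm_mul]
      refine mul_le_of_le_one_right (norm_nonneg _) ?_
      rw [Real.norm_eq_abs, abs_le]
      constructor <;> simp only [hρ] <;>
      linarith [Real.smoothTransition.nonneg ((σ - s) / ε),
        Real.smoothTransition.le_one ((σ - s) / ε),
        Real.smoothTransition.nonneg ((σ - t) / ε), Real.smoothTransition.le_one ((σ - t) / ε)]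
    · refine tendsto_const_nhds.congr' ?_
      have key : ∀ c, ∀ᶠ ε : ℝ in 𝓝[>] 0, Real.smoothTransition ((σ - c) / ε) =
          (Ioi c).indicator (fun _ => 1) σ := fun c => by
        by_cases hc : c < σ
        · have : ∀ᶠ ε : ℝ in 𝓝[>] 0, ε < σ - c :=
            nhdsWithin_le_nhds (Iio_mem_nhds (by linarith))
          filter_upwards [self_mem_nhdsWithin, this] with ε h1 h2
          rw [indicator_of_mem (mem_Ioi.2 hc)]
          exact Real.smoothTransition.one_of_one_le ((one_le_div h1).2 h2.le)
        · filter_upwards [self_mem_nhdsWithin] with ε h1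
          rw [indicator_of_notMem (by simpa using hc)]
          exact Real.smoothTransition.zero_of_nonpos
            (div_nonpos_of_nonpos_of_nonneg (by linarith [not_lt.1 hc]) (le_of_lt h1))
      filter_upwards [key s, key t] with ε h1 h2
      simp only [hρ, h1, h2, indicator, mem_Ioi, mem_Ioc]
      by_cases hs' : s < σ <;> by_cases ht' : t < σ
      · simp [hs', ht', not_le.2 ht']
      · simp [hs', ht', not_lt.1 ht']
      · exact absurd (hst.trans_lt ht') hs'
      · simp [hs', ht']
  have hlim := tendsto_nhds_unique_of_eventuallyEq hL hR (by
    filter_upwards [hev] with ε hε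
    refine hw _ (hρs ε) (HasCompactSupport.of_support_subset_isCompact isCompact_Icc
      ((subset_tsupport _).trans (hρsupp ε hε.1))) ?_
    exact (hρsupp ε hε.1).trans fun σ hσ => ⟨by linarith [hσ.1], by linarith [hσ.2, hε.2]⟩)
  rw [hlim, setIntegral_indicator measurableSet_Ioc, intervalIntegral.integral_of_le hst,
    inter_eq_self_of_subset_right]
  exact fun σ hσ => ⟨by linarith [hσ.1], by linarith [hσ.2]⟩

/-! ### Pairings in L² and time slices of fields on the cylinder. -/

section L2

variable {X V : Type*} [MeasurableSpace X] [NormedAddCommGroup V] [InnerProductSpace ℝ V]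

/-- With value and gradient combined in one Hilbert space, the duality `g₀ φ + g · Dφ` becomes a
single inner product. -/
theorem memLp_two_pair {N : ℕ} {m : Measure X} {a : X → ℝ} {b : X → Space N} (ha : MemLp a 2 m)
    (hb : MemLp b 2 m) : MemLp (fun z => WithLp.toLp 2 (a z, b z)) 2 m := by
  have hm : AEStronglyMeasurable (fun z => WithLp.toLp 2 (a z, b z)) m :=
    (WithLp.prod_continuous_toLp 2 ℝ (Space N)).comp_aestronglyMeasurable (ha.1.prodMk hb.1)
  rw [memLp_two_iff_integrable_sq_norm hm]
  simp only [WithLp.prod_norm_sq_eq_of_L2]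
  exact ((memLp_two_iff_integrable_sq_norm ha.1).1 ha).add
    ((memLp_two_iff_integrable_sq_norm hb.1).1 hb)

theorem integrable_inner_of_memLp_two {m : Measure X} {F G : X → V} (hF : MemLp F 2 m)
    (hG : MemLp G 2 m) : Integrable (fun z => inner ℝ (F z) (G z)) m := by
  refine (L2.integrable_inner (𝕜 := ℝ) (hF.toLp F) (hG.toLp G)).congr ?_
  filter_upwards [hF.coeFn_toLp, hG.coeFn_toLp] with z h1 h2
  rw [h1, h2]

theorem abs_integral_inner_le {m : Measure X} {F G : X → V} (hF : MemLp F 2 m)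
    (hG : MemLp G 2 m) : |∫ z, inner ℝ (F z) (G z) ∂m| ≤
      (eLpNorm F 2 m).toReal * (eLpNorm G 2 m).toReal := by
  have h := norm_inner_le_norm (𝕜 := ℝ) (hF.toLp F) (hG.toLp G)
  rw [L2.inner_def, Lp.norm_toLp, Lp.norm_toLp] at h
  refine le_trans (le_of_eq ?_) h
  rw [← Real.norm_eq_abs]
  congr 1
  refine integral_congr_ae ?_
  filter_upwards [hF.coeFn_toLp, hG.coeFn_toLp] with z h1 h2
  rw [h1, h2]

theorem toReal_eLpNorm_two_sq {m : Measure X} {F : X → V} (hF : MemLp F 2 m) :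
    (eLpNorm F 2 m).toReal ^ 2 = ∫ z, ‖F z‖ ^ 2 ∂m := by
  have := norm_sq_eq_re_inner (𝕜 := ℝ) (hF.toLp F)
  rw [L2.inner_def, Lp.norm_toLp] at this
  rw [this, RCLike.re_to_real]
  refine integral_congr_ae ?_
  filter_upwards [hF.coeFn_toLp] with z h1
  rw [h1, real_inner_self_eq_norm_sq]

theorem toReal_eLpNorm_two_le {m : Measure X} {F : X → V} (hF : MemLp F 2 m) :
    (eLpNorm F 2 m).toReal ≤ 1 + ∫ z, ‖F z‖ ^ 2 ∂m := by
  rw [← toReal_eLpNorm_two_sq hF]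
  nlinarith [sq_nonneg ((eLpNorm F 2 m).toReal - 1)]

end L2

section Slice

variable {X V : Type*} [MeasurableSpace X] [NormedAddCommGroup V]
  {Y : Type*} [MeasurableSpace Y] {μ : Measure X} {ν : Measure Y} [SFinite μ] [SFinite ν]

theorem memLp_two_slice {F : X × Y → V} (hF : MemLp F 2 (μ.prod ν)) :
    ∀ᵐ t ∂ν, MemLp (fun x => F (x, t)) 2 μ := by
  have h := ((memLp_two_iff_integrable_sq_norm hF.1).1 hF).prod_left_ae
  filter_upwards [h, hF.1.prodMk_right] with t h1 h2
  exact (memLp_two_iff_integrable_sq_norm h2).2 h1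

theorem integrable_sq_norm_slice {F : X × Y → V} (hF : MemLp F 2 (μ.prod ν)) :
    Integrable (fun t => ∫ x, ‖F (x, t)‖ ^ 2 ∂μ) ν :=
  ((memLp_two_iff_integrable_sq_norm hF.1).1 hF).integral_prod_right

end Slice

theorem cylMeasure_eq_prod {N : ℕ} (Ω : Set (Space N)) (T : ℝ) :
    cylMeasure Ω T = (volume.restrict Ω).prod (volume.restrict (Ioo 0 T)) := by
  rw [Measure.prod_restrict]
  rfl

section Flux

variable {N : ℕ} {μ : Measure (Space N)} [IsFiniteMeasure μ] {V : Type*} [NormedAddCommGroup V]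
  [InnerProductSpace ℝ V] {T : ℝ} {G : Space N × ℝ → V}

/-- A time-dependent field in `L²`, vanishing outside `(0,T)`, paired with a fixed field in `L²`. -/
theorem integrable_flux (hG : MemLp G 2 (μ.prod volume)) (hG0 : ∀ z, z.2 ∉ Ioo 0 T → G z = 0)
    {D : Space N → V} (hD : MemLp D 2 μ) :
    Integrable fun σ => ∫ x, inner ℝ (G (x, σ)) (D x) ∂μ := by
  have h1 : MemLp G 2 (μ.prod (volume.restrict (Ioo 0 T))) := by
    have : μ.prod (volume.restrict (Ioo 0 T)) = (μ.prod volume).restrict (univ ×ˢ Ioo 0 T) := by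
      rw [← Measure.prod_restrict, Measure.restrict_univ]
    rw [this]
    exact hG.restrict _
  have h2 := (integrable_inner_of_memLp_two h1
    (hD.comp_fst (volume.restrict (Ioo 0 T)))).integral_prod_right
  have h3 : (fun σ => ∫ x, inner ℝ (G (x, σ)) (D x) ∂μ) =
      (Ioo 0 T).indicator fun σ => ∫ x, inner ℝ (G (x, σ)) (D x) ∂μ := by
    ext σ
    by_cases hσ : σ ∈ Ioo 0 T
    · rw [indicator_of_mem hσ]
    · rw [indicator_of_notMem hσ]
      simp [hG0 (_, σ) hσ]
  rw [h3, integrable_indicator_iff measurableSet_Ioo]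
  exact h2

/-- On each slice the error is at most `‖G(σ)‖₂ ‖D_j - D‖₂`, and `‖G(σ)‖₂ ≤ 1 + ‖G(σ)‖₂²` is
integrable over the bounded interval. -/
theorem tendsto_integral_flux (hG : MemLp G 2 (μ.prod volume))
    (hG0 : ∀ z, z.2 ∉ Ioo 0 T → G z = 0) {D : Space N → V} {Dj : ℕ → Space N → V}
    (hD : MemLp D 2 μ) (hDj : ∀ j, MemLp (Dj j) 2 μ)
    (hlim : Tendsto (fun j => eLpNorm (Dj j - D) 2 μ) atTop (𝓝 0)) {s t : ℝ} (hst : s ≤ t) :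
    Tendsto (fun j => ∫ σ in s..t, ∫ x, inner ℝ (G (x, σ)) (Dj j x) ∂μ) atTop
      (𝓝 (∫ σ in s..t, ∫ x, inner ℝ (G (x, σ)) (D x) ∂μ)) := by
  have hint : IntervalIntegrable (fun σ => 1 + ∫ x, ‖G (x, σ)‖ ^ 2 ∂μ) volume s t :=
    intervalIntegrable_const.add (integrable_sq_norm_slice hG).intervalIntegrable
  rw [tendsto_iff_norm_sub_tendsto_zero]
  have hz : Tendsto (fun j => (∫ σ in s..t, (1 + ∫ x, ‖G (x, σ)‖ ^ 2 ∂μ)) *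
      (eLpNorm (Dj j - D) 2 μ).toReal) atTop (𝓝 0) := by
    have := ((ENNReal.tendsto_toReal ENNReal.zero_ne_top).comp hlim).const_mul
      (∫ σ in s..t, (1 + ∫ x, ‖G (x, σ)‖ ^ 2 ∂μ))
    simpa using this
  refine squeeze_zero (fun j => norm_nonneg _) (fun j => ?_) hz
  rw [← intervalIntegral.integral_sub (integrable_flux hG hG0 (hDj j)).intervalIntegrable
    (integrable_flux hG hG0 hD).intervalIntegrable, ← intervalIntegral.integral_mul_const]
  refine intervalIntegral.norm_integral_le_of_norm_le hst ?_ (hint.mul_const _)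
  filter_upwards [memLp_two_slice hG] with σ hσ _
  rw [← integral_sub (integrable_inner_of_memLp_two hσ (hDj j))
    (integrable_inner_of_memLp_two hσ hD)]
  simp only [← inner_sub_right]
  refine (abs_integral_inner_le hσ ((hDj j).sub hD)).trans ?_
  exact mul_le_mul_of_nonneg_right (toReal_eLpNorm_two_le hσ) ENNReal.toReal_nonneg

end Flux

theorem continuous_integral_mul {X : Type*} [MeasurableSpace X] {μ : Measure X}
    {U : ℝ → Lp ℝ 2 μ} (hU : Continuous U) {φ : X → ℝ} (hφ : MemLp φ 2 μ) :
    Continuous fun t => ∫ x, U t x * φ x ∂μ := by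
  have : ∀ t, ∫ x, U t x * φ x ∂μ = inner ℝ (hφ.toLp φ) (U t) := by
    intro t
    rw [L2.inner_def]
    refine integral_congr_ae ?_
    filter_upwards [hφ.coeFn_toLp] with x hx
    rw [hx]
    simp
  simp only [this]
  fun_prop

/-! ### Increments of `u` as time integrals of the functional `∂_t u`. -/

section TimeDerivative

variable {N : ℕ} {Ω : Set (Space N)} {T : ℝ} {u g₀ : Space N × ℝ → ℝ} {g : Space N × ℝ → Space N}

/-- The components of an element of `L²(0,T; W^{-1,2}(Ω))`, extended by zero outside `(0,T)`. -/
noncomputable def fluxExt (T : ℝ) (g₀ : Space N × ℝ → ℝ) (g : Space N × ℝ → Space N) :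
    Space N × ℝ → WithLp 2 (ℝ × Space N) :=
  (univ ×ˢ Ioo 0 T).indicator fun z => WithLp.toLp 2 (g₀ z, g z)

theorem fluxExt_eq_zero (z : Space N × ℝ) (hz : z.2 ∉ Ioo 0 T) : fluxExt T g₀ g z = 0 :=
  indicator_of_notMem (fun h => hz h.2) _

theorem fluxExt_eq (z : Space N × ℝ) (hz : z.2 ∈ Ioo 0 T) :
    fluxExt T g₀ g z = WithLp.toLp 2 (g₀ z, g z) :=
  indicator_of_mem (mk_mem_prod (mem_univ _) hz) _

theorem memLp_fluxExt (h₀ : MemLp g₀ 2 (cylMeasure Ω T)) (h : MemLp g 2 (cylMeasure Ω T)) :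
    MemLp (fluxExt T g₀ g) 2 ((volume.restrict Ω).prod volume) := by
  have h1 := memLp_two_pair h₀ h
  rw [fluxExt, memLp_indicator_iff_restrict (MeasurableSet.univ.prod measurableSet_Ioo),
    ← Measure.prod_restrict, Measure.restrict_univ, ← cylMeasure_eq_prod]
  exact h1

theorem inner_pair (a b : ℝ) (v w : Space N) :
    inner ℝ (WithLp.toLp 2 (a, v)) (WithLp.toLp 2 (b, w)) = a * b + inner ℝ v w := by
  rw [WithLp.prod_inner_apply]
  simp [mul_comm]

theorem gradient_mul_const {χ : Space N → ℝ} (hχ : ContDiff ℝ ∞ χ) (c : ℝ) (x : Space N) :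
    gradient (fun y => χ y * c) x = c • gradient χ x := by
  have h : HasFDerivAt (fun y => χ y * c) (c • fderiv ℝ χ x) x :=
    ((hχ.differentiable (by simp) x).hasFDerivAt).mul_const c
  simp only [gradient, h.fderiv, map_smulₛₗ]
  simp

variable (hΩb : Bornology.IsBounded Ω) (hu : MemLp u 2 (cylMeasure Ω T))
  (htd : HasTimeDerivative Ω T u g₀ g) {U : ℝ → Lp ℝ 2 (volume.restrict Ω)} (hUc : Continuous U)
  (hU0 : ∀ t ≤ 0, U t = 0)
  (hUu : ∀ᵐ t ∂(volume.restrict (Ioo 0 T)), (fun x => u (x, t)) =ᵐ[volume.restrict Ω] U t)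

include hΩb hu htd hUc hU0 hUu

/-- Products `χ(x) ρ(t)` reduce the distributional derivative on Q to the scalar weak derivative of
`t ↦ ∫ U(t) χ`, which is then integrated from `s > 0`. Continuity and the zero initial datum allow
`s → 0`; for `t ≤ 0` both sides vanish by the chosen extensions. -/
theorem integral_mul_testFunction_eq {χ : Space N → ℝ} (hχ : ContDiff ℝ ∞ χ)
    (hχc : HasCompactSupport χ) (hχΩ : tsupport χ ⊆ Ω) {t : ℝ} (ht : t < T) :
    ∫ x in Ω, U t x * χ x = ∫ σ in (0 : ℝ)..t, ∫ x in Ω,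
      inner ℝ (fluxExt T g₀ g (x, σ)) (WithLp.toLp 2 (χ x, gradient χ x)) := by
  have : IsFiniteMeasure (volume.restrict Ω) := ⟨by
    rw [Measure.restrict_apply_univ]; exact hΩb.measure_lt_top⟩
  have hgc := continuous_gradient hχ
  have hgs : HasCompactSupport (gradient χ) := by
    refine HasCompactSupport.intro hχc fun x hx => ?_
    have : fderiv ℝ χ x = 0 :=
      image_eq_zero_of_notMem_tsupport fun h => hx (tsupport_fderiv_subset ℝ h)
    simp [gradient, this]
  have hχ2 : MemLp χ 2 (volume.restrict Ω) := hχ.continuous.memLp_of_hasCompactSupport hχc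
  have hχg2 : MemLp (gradient χ) 2 (volume.restrict Ω) := hgc.memLp_of_hasCompactSupport hgs
  have hD := memLp_two_pair hχ2 hχg2
  have hG := memLp_fluxExt htd.1 htd.2.1
  set b : ℝ → ℝ := fun t => ∫ x in Ω, U t x * χ x with hb
  have hbc : Continuous b := continuous_integral_mul hUc hχ2
  set a : ℝ → ℝ := fun σ => ∫ x in Ω,
      inner ℝ (fluxExt T g₀ g (x, σ)) (WithLp.toLp 2 (χ x, gradient χ x)) with ha
  have hai : Integrable a := integrable_flux hG fluxExt_eq_zero hD
  have hb0 : ∀ t ≤ 0, b t = 0 := fun t ht0 => by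
    have : ∫ x in Ω, U t x * χ x = ∫ x in Ω, 0 := by
      refine integral_congr_ae ?_
      rw [hU0 t ht0]
      filter_upwards [Lp.coeFn_zero ℝ 2 (volume.restrict Ω)] with x hx
      rw [hx]; simp
    simp only [hb, this, integral_zero]
  have ha0 : ∀ t ≤ 0, a t = 0 := fun t ht0 => by
    have : ∀ x, fluxExt T g₀ g (x, t) = 0 := fun x =>
      fluxExt_eq_zero _ fun h => absurd h.1 (not_lt.2 ht0)
    simp [ha, this]
  rcases le_or_gt t 0 with ht0 | ht0
  · change b t = _
    rw [hb0 t ht0, intervalIntegral.integral_symm, intervalIntegral.integral_of_le ht0]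
    symm
    rw [neg_eq_zero]
    exact setIntegral_eq_zero_of_forall_eq_zero fun σ hσ => ha0 σ hσ.2
  · -- the weak formulation with a product test function
    have hw : ∀ ρ : ℝ → ℝ, ContDiff ℝ ∞ ρ → HasCompactSupport ρ → tsupport ρ ⊆ Ioo 0 T →
        -∫ σ in Ioo 0 T, b σ * deriv ρ σ = ∫ σ in Ioo 0 T, a σ * ρ σ := by
      intro ρ hρ hρc hρT
      have hsub : tsupport (fun z : Space N × ℝ => χ z.1 * ρ z.2) ⊆ tsupport χ ×ˢ tsupport ρ := by
        refine closure_minimal (fun z hz => ?_)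
          ((isClosed_tsupport χ).prod (isClosed_tsupport ρ))
        exact ⟨subset_tsupport _ (left_ne_zero_of_mul hz), subset_tsupport _
          (right_ne_zero_of_mul hz)⟩
      have hcomp : HasCompactSupport (fun z : Space N × ℝ => χ z.1 * ρ z.2) :=
        (hχc.isCompact.prod hρc.isCompact).of_isClosed_subset (isClosed_tsupport _) hsub
      have key := htd.2.2 (fun z => χ z.1 * ρ z.2)
        ((hχ.comp contDiff_fst).mul (hρ.comp contDiff_snd)) hcomp
        (hsub.trans (prod_mono hχΩ hρT))
      have hρ' : Continuous (deriv ρ) := hρ.continuous_deriv (by simp)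
      have hderiv : ∀ z : Space N × ℝ, deriv (fun s => χ z.1 * ρ s) z.2 = χ z.1 * deriv ρ z.2 :=
        fun z => deriv_const_mul _ (hρ.differentiable (by simp) _)
      simp only [hderiv, gradient_mul_const hχ] at key
      obtain ⟨Cρ, hCρ⟩ := hρ.continuous.bounded_above_of_compact_support hρc
      obtain ⟨Cρ', hCρ'⟩ := hρ'.bounded_above_of_compact_support hρc.deriv
      have hfst2 : MemLp (fun z : Space N × ℝ => χ z.1) 2 (cylMeasure Ω T) := by
        rw [cylMeasure_eq_prod]; exact hχ2.comp_fst _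
      have hfstg2 : MemLp (fun z : Space N × ℝ => gradient χ z.1) 2 (cylMeasure Ω T) := by
        rw [cylMeasure_eq_prod]; exact hχg2.comp_fst _
      have hi1 : Integrable (fun z => u z * (χ z.1 * deriv ρ z.2)) (cylMeasure Ω T) := by
        have e1 : Integrable (fun z => u z * χ z.1) (cylMeasure Ω T) := hu.integrable_mul hfst2
        have e2 := e1.mul_bdd (c := Cρ') (hρ'.comp continuous_snd).aestronglyMeasurable
          (Eventually.of_forall fun z => hCρ' z.2)
        refine e2.congr (Eventually.of_forall fun z => ?_)
        simp only [Function.comp_apply]; ring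
      have hi2 : Integrable (fun z => g₀ z * (χ z.1 * ρ z.2) +
          inner ℝ (g z) (ρ z.2 • gradient χ z.1)) (cylMeasure Ω T) := by
        have e1 : Integrable (fun z => g₀ z * χ z.1 + inner ℝ (g z) (gradient χ z.1))
            (cylMeasure Ω T) := (htd.1.integrable_mul hfst2).add
          (integrable_inner_of_memLp_two htd.2.1 hfstg2)
        have e2 := e1.mul_bdd (c := Cρ) (hρ.continuous.comp continuous_snd).aestronglyMeasurable
          (Eventually.of_forall fun z => hCρ z.2)
        refine e2.congr (Eventually.of_forall fun z => ?_)
        simp only [Function.comp_apply, inner_smul_right]; ring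
      rw [cylMeasure_eq_prod] at key hi1 hi2
      rw [integral_prod_symm _ hi1, integral_prod_symm _ hi2] at key
      refine (Eq.trans ?_ key).trans ?_
      · congr 1
        refine integral_congr_ae ?_
        filter_upwards [hUu] with σ hσ
        simp only [hb]
        rw [← integral_mul_const]
        refine integral_congr_ae ?_
        filter_upwards [hσ] with x hx
        rw [← hx]; ring
      · refine setIntegral_congr_fun measurableSet_Ioo fun σ hσ => ?_
        simp only [ha]
        rw [← integral_mul_const]
        refine integral_congr_ae (Eventually.of_forall fun x => ?_)
        simp only [fluxExt_eq (x, σ) hσ, inner_pair, inner_smul_right]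
        ring
    -- difference of the two sides, as `s → 0`
    have hc1 : Tendsto (fun s => b t - b s) (𝓝[>] 0) (𝓝 (b t - b 0)) :=
      ((continuous_const.sub hbc).tendsto 0).mono_left nhdsWithin_le_nhds
    have hc2 : Tendsto (fun s => (∫ σ in (0 : ℝ)..t, a σ) - ∫ σ in (0 : ℝ)..s, a σ) (𝓝[>] 0)
        (𝓝 ((∫ σ in (0 : ℝ)..t, a σ) - ∫ σ in (0 : ℝ)..0, a σ)) := by
      have : Continuous fun s => ∫ σ in (0 : ℝ)..s, a σ :=
        intervalIntegral.continuous_primitive (fun _ _ => hai.intervalIntegrable) 0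
      exact ((continuous_const.sub this).tendsto 0).mono_left nhdsWithin_le_nhds
    have heq := tendsto_nhds_unique_of_eventuallyEq hc1 hc2 (by
      have hlt : ∀ᶠ s : ℝ in 𝓝[>] 0, s < t := nhdsWithin_le_nhds (Iio_mem_nhds ht0)
      filter_upwards [self_mem_nhdsWithin, hlt] with s hs hst
      rw [sub_eq_integral_of_weak_deriv hbc hai.integrableOn hw hs hst.le ht,
        intervalIntegral.integral_interval_sub_left hai.intervalIntegrable
          hai.intervalIntegrable])
    rw [hb0 0 le_rfl, intervalIntegral.integral_same, sub_zero, sub_zero] at heq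
    exact heq

/-- The time increments of `u` tested with functions in `W₀^{1,2}(Ω)`. -/
theorem integral_sub_mul_eq {φ : Space N → ℝ} {Dφ : Space N → Space N} (hφ : MemW012 Ω φ Dφ)
    {s t : ℝ} (hst : s ≤ t) (ht : t < T) :
    ∫ x in Ω, (U t x - U s x) * φ x = ∫ σ in s..t, ∫ x in Ω,
      inner ℝ (fluxExt T g₀ g (x, σ)) (WithLp.toLp 2 (φ x, Dφ x)) := by
  have : IsFiniteMeasure (volume.restrict Ω) := ⟨by
    rw [Measure.restrict_apply_univ]; exact hΩb.measure_lt_top⟩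
  obtain ⟨hφ2, hDφ2, ψ, hψ, hl, hg⟩ := hφ
  have hψ2 : ∀ j, MemLp (ψ j) 2 (volume.restrict Ω) := fun j =>
    (hψ j).1.continuous.memLp_of_hasCompactSupport (hψ j).2.1
  have hψg2 : ∀ j, MemLp (gradient (ψ j)) 2 (volume.restrict Ω) := fun j => by
    refine (continuous_gradient (hψ j).1).memLp_of_hasCompactSupport ?_
    refine HasCompactSupport.intro (hψ j).2.1 fun x hx => ?_
    have : fderiv ℝ (ψ j) x = 0 :=
      image_eq_zero_of_notMem_tsupport fun h => hx (tsupport_fderiv_subset ℝ h)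
    simp [gradient, this]
  have hG := memLp_fluxExt htd.1 htd.2.1
  have hUm : ∀ r, MemLp (U r) 2 (volume.restrict Ω) := fun r => Lp.memLp _
  have hj : ∀ j, ∫ x in Ω, inner ℝ (U t x - U s x) (ψ j x) = ∫ σ in s..t, ∫ x in Ω,
      inner ℝ (fluxExt T g₀ g (x, σ)) (WithLp.toLp 2 (ψ j x, gradient (ψ j) x)) := by
    intro j
    have e := fun r (hr : r < T) => integral_mul_testFunction_eq hΩb hu htd hUc hU0 hUu
      (hψ j).1 (hψ j).2.1 (hψ j).2.2 hr
    have hi := integrable_flux hG fluxExt_eq_zero (memLp_two_pair (hψ2 j) (hψg2 j))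
    rw [← intervalIntegral.integral_interval_sub_left hi.intervalIntegrable
      hi.intervalIntegrable, ← e t ht, ← e s (hst.trans_lt ht),
      ← integral_sub (f := fun x => U t x * ψ j x) (g := fun x => U s x * ψ j x)
        ((hUm t).integrable_mul (hψ2 j)) ((hUm s).integrable_mul (hψ2 j))]
    refine integral_congr_ae (Eventually.of_forall fun x => ?_)
    simp; ring
  have hR := tendsto_integral_flux hG fluxExt_eq_zero (memLp_two_pair hφ2 hDφ2)
    (fun j => memLp_two_pair (hψ2 j) (hψg2 j)) (by
      have h0 := hl.add hg
      rw [add_zero] at h0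
      refine tendsto_of_tendsto_of_tendsto_of_le_of_le tendsto_const_nhds h0 (fun _ => zero_le)
        fun j => ?_
      have e1 : AEStronglyMeasurable (fun x => ψ j x - φ x) (volume.restrict Ω) :=
        ((hψ2 j).sub hφ2).1
      have e2 : AEStronglyMeasurable (fun x => gradient (ψ j) x - Dφ x) (volume.restrict Ω) :=
        ((hψg2 j).sub hDφ2).1
      refine le_trans (eLpNorm_mono (g := fun x => ‖ψ j x - φ x‖ + ‖gradient (ψ j) x - Dφ x‖)
        fun x => ?_) ((eLpNorm_add_le e1.norm e2.norm (by norm_num)).trans_eq ?_)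
      · rw [Pi.sub_apply, ← WithLp.toLp_sub, Real.norm_of_nonneg (by positivity)]
        refine abs_le_of_sq_le_sq' ?_ (by positivity) |>.2
        rw [WithLp.prod_norm_sq_eq_of_L2]
        change ‖ψ j x - φ x‖ ^ 2 + ‖gradient (ψ j) x - Dφ x‖ ^ 2 ≤ _
        nlinarith [norm_nonneg (ψ j x - φ x), norm_nonneg (gradient (ψ j) x - Dφ x)]
      · rw [eLpNorm_norm, eLpNorm_norm]) hst
  have hL : Tendsto (fun j => ∫ x in Ω, inner ℝ (U t x - U s x) (ψ j x)) atTop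
      (𝓝 (∫ x in Ω, inner ℝ (U t x - U s x) (φ x))) := by
    have hd : MemLp (fun x => U t x - U s x) 2 (volume.restrict Ω) := (hUm t).sub (hUm s)
    rw [tendsto_iff_norm_sub_tendsto_zero]
    have hz := ((ENNReal.tendsto_toReal ENNReal.zero_ne_top).comp hl).const_mul
      (eLpNorm (fun x => U t x - U s x) 2 (volume.restrict Ω)).toReal
    rw [ENNReal.toReal_zero, mul_zero] at hz
    refine squeeze_zero (fun j => norm_nonneg _) (fun j => ?_) hz
    rw [← integral_sub (integrable_inner_of_memLp_two hd (hψ2 j))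
      (integrable_inner_of_memLp_two hd hφ2)]
    simp only [← inner_sub_right]
    exact abs_integral_inner_le hd ((hψ2 j).sub hφ2)
  simp only [hj] at hL
  rw [← tendsto_nhds_unique hL hR]
  refine integral_congr_ae (Eventually.of_forall fun x => ?_)
  simp [mul_comm]

end TimeDerivative

/-! ### Averages over short time windows. -/

theorem integral_sub_translate {e : ℝ → ℝ} (he : Continuous e) (τ r : ℝ) :
    ∫ t in (0 : ℝ)..τ, (e t - e (t - r)) = (∫ t in (τ - r)..τ, e t) - ∫ t in (-r)..0, e t := by
  have hi : ∀ a b : ℝ, IntervalIntegrable e volume a b := fun a b => he.intervalIntegrable a b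
  have hc : Continuous fun t => e (t - r) := by fun_prop
  rw [intervalIntegral.integral_sub (hi 0 τ) (hc.intervalIntegrable 0 τ),
    intervalIntegral.integral_comp_sub_right (fun t => e t) r, zero_sub]
  have h1 := intervalIntegral.integral_add_adjacent_intervals (hi (-r) 0) (hi 0 τ)
  have h2 := intervalIntegral.integral_add_adjacent_intervals (hi (-r) (τ - r)) (hi (τ - r) τ)
  linarith

theorem continuous_integral_window {β : ℝ → ℝ} (hβ : Integrable β) (r : ℝ) :
    Continuous fun t => ∫ σ in (t - r)..t, β σ := by
  have hB : Continuous fun t => ∫ σ in (0 : ℝ)..t, β σ :=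
    intervalIntegral.continuous_primitive (fun _ _ => hβ.intervalIntegrable) 0
  have : (fun t => ∫ σ in (t - r)..t, β σ) = fun t =>
      (∫ σ in (0 : ℝ)..t, β σ) - ∫ σ in (0 : ℝ)..(t - r), β σ := by
    ext t
    rw [intervalIntegral.integral_interval_sub_left hβ.intervalIntegrable hβ.intervalIntegrable]
  rw [this]
  exact hB.sub (hB.comp (continuous_id.sub continuous_const))

/-- Each `σ` lies in windows `(t-r,t)` for a set of `t` of length at most `r`. In terms of the
nondecreasing primitive of `β`, the left side is a difference of two integrals over intervals of
length `r`, each compared with an endpoint value. -/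
theorem integral_integral_window_le {β : ℝ → ℝ} (hβ : Integrable β) (h0 : ∀ t, 0 ≤ β t) {τ r : ℝ}
    (hτ : 0 ≤ τ) (hr : 0 ≤ r) :
    ∫ t in (0 : ℝ)..τ, ∫ σ in (t - r)..t, β σ ≤ r * ∫ σ, β σ := by
  set B : ℝ → ℝ := fun t => ∫ σ in (0 : ℝ)..t, β σ with hB
  have hBc : Continuous B :=
    intervalIntegral.continuous_primitive (fun _ _ => hβ.intervalIntegrable) 0
  have hdiff : ∀ a b, B b - B a = ∫ σ in a..b, β σ := fun a b =>
    intervalIntegral.integral_interval_sub_left hβ.intervalIntegrable hβ.intervalIntegrable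
  have hmono : Monotone B := fun a b hab => by
    have := intervalIntegral.integral_nonneg (μ := volume) hab fun t _ => h0 t
    rw [← hdiff] at this
    linarith
  have e1 : ∫ t in (τ - r)..τ, B t ≤ r * B τ := by
    have := intervalIntegral.integral_mono_on (μ := volume) (by linarith : τ - r ≤ τ)
      (hBc.intervalIntegrable _ _) ((continuous_const (y := B τ)).intervalIntegrable _ _)
      (fun t ht => hmono ht.2)
    simpa using this
  have e2 : r * B (-r) ≤ ∫ t in (-r)..0, B t := by
    have := intervalIntegral.integral_mono_on (μ := volume) (by linarith : -r ≤ 0)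
      ((continuous_const (y := B (-r))).intervalIntegrable _ _)
      (hBc.intervalIntegrable _ _) (fun t ht => hmono ht.1)
    simpa using this
  have e3 : B τ - B (-r) ≤ ∫ σ, β σ := by
    rw [hdiff, intervalIntegral.integral_of_le (by linarith)]
    exact setIntegral_le_integral hβ (Eventually.of_forall h0)
  simp only [← hdiff]
  rw [integral_sub_translate hBc]
  calc _ ≤ r * (B τ - B (-r)) := by rw [mul_sub]; linarith
    _ ≤ _ := mul_le_mul_of_nonneg_left e3 hr

theorem inner_le_of_norm {V : Type*} [NormedAddCommGroup V] [InnerProductSpace ℝ V] (v w : V)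
    {c : ℝ} (hc : 0 < c) : inner ℝ v w ≤ c⁻¹ * ‖v‖ ^ 2 + c * ‖w‖ ^ 2 := by
  have h1 := real_inner_le_norm v w
  have h2 : 2 * (‖v‖ * ‖w‖) ≤ c⁻¹ * ‖v‖ ^ 2 + c * ‖w‖ ^ 2 := by
    have e : c⁻¹ * ‖v‖ ^ 2 + c * ‖w‖ ^ 2 - 2 * (‖v‖ * ‖w‖) = c⁻¹ * (‖v‖ - c * ‖w‖) ^ 2 := by
      field_simp; ring
    have : 0 ≤ c⁻¹ * (‖v‖ - c * ‖w‖) ^ 2 := by positivity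
    linarith
  have h3 : 0 ≤ ‖v‖ * ‖w‖ := by positivity
  linarith

/-- Averages over short time intervals of a pairing in `L²` are almost bounded by the pairing. -/
theorem eventually_integral_window_flux_le {N : ℕ} {μ : Measure (Space N)} [IsFiniteMeasure μ]
    {V : Type*} [NormedAddCommGroup V] [InnerProductSpace ℝ V] {T : ℝ} {G D : Space N × ℝ → V}
    (hG : MemLp G 2 (μ.prod volume)) (hG0 : ∀ z, z.2 ∉ Ioo 0 T → G z = 0) {τ : ℝ} (hτ : 0 ≤ τ)
    (hD : MemLp D 2 (μ.prod (volume.restrict (Ioo 0 τ)))) {δ : ℝ} (hδ : 0 < δ) :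
    ∀ᶠ r : ℝ in 𝓝[>] 0, ∃ m : ℝ → ℝ, IntegrableOn m (Ioo 0 τ) ∧
      (∀ᵐ t ∂(volume.restrict (Ioo 0 τ)),
        ∫ σ in (t - r)..t, ∫ x, inner ℝ (G (x, σ)) (D (x, t)) ∂μ ≤ m t) ∧
      ∫ t in Ioo 0 τ, m t ≤
        r * ((∫ t in Ioo 0 τ, ∫ x, inner ℝ (G (x, t)) (D (x, t)) ∂μ) + δ) := by
  set ν : Measure ℝ := volume.restrict (Ioo 0 τ) with hν
  have hκi : Integrable (fun z => 1 + ‖D z‖ ^ 2) (μ.prod ν) :=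
    (integrable_const 1).add ((memLp_two_iff_integrable_sq_norm hD.1).1 hD)
  set κ : ℝ → ℝ := fun t => ∫ x, (1 + ‖D (x, t)‖ ^ 2) ∂μ with hκ
  have hκ1 : Integrable κ ν := hκi.integral_prod_right
  set k : ℝ := ∫ t, κ t ∂ν with hk
  have hk0 : 0 ≤ k := integral_nonneg fun t => integral_nonneg fun x => by positivity
  -- The error budget: `3 c k ≤ δ/2`, while `∫ β ≤ ε² ≤ ε ≤ c δ/4` makes each of the two
  -- approximation errors, weighted by `c⁻¹`, cost at most `δ/4`.
  set c : ℝ := δ / (6 * (k + 1)) with hc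
  have hc0 : 0 < c := by positivity
  -- approximation of `G` by a continuous function with compact support
  set ε : ℝ := min 1 (c * δ / 4) with hε
  have hε0 : 0 < ε := lt_min one_pos (by positivity)
  obtain ⟨γ, hγs, hγε, hγc, hγ2⟩ := hG.exists_hasCompactSupport_eLpNorm_sub_le
    ENNReal.ofNat_ne_top (ε := ENNReal.ofReal ε) (by simpa using hε0)
  have hR := hG.sub hγ2
  set β : ℝ → ℝ := fun t => ∫ x, ‖G (x, t) - γ (x, t)‖ ^ 2 ∂μ with hβ
  have hβi : Integrable β := integrable_sq_norm_slice hR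
  have hβ0 : ∀ t, 0 ≤ β t := fun t => integral_nonneg fun x => by positivity
  have hb : ∫ t, β t ≤ c * δ / 4 := by
    have h1 : ∫ t, β t = (eLpNorm (G - γ) 2 (μ.prod volume)).toReal ^ 2 := by
      rw [toReal_eLpNorm_two_sq hR,
        integral_prod_symm _ ((memLp_two_iff_integrable_sq_norm hR.1).1 hR)]
      rfl
    have h2 : (eLpNorm (G - γ) 2 (μ.prod volume)).toReal ≤ ε :=
      ENNReal.toReal_le_of_le_ofReal hε0.le hγε
    have h3 : ε ^ 2 ≤ ε := by
      have : ε ≤ 1 := min_le_left _ _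
      nlinarith
    rw [h1]
    exact (pow_le_pow_left₀ ENNReal.toReal_nonneg h2 2).trans (h3.trans (min_le_right _ _))
  obtain ⟨r₀, hr₀, huc⟩ := Metric.uniformContinuous_iff.1
    (hγs.uniformContinuous_of_continuous hγc) c hc0
  have hGν : MemLp G 2 (μ.prod ν) := by
    have : μ.prod ν = (μ.prod volume).restrict (univ ×ˢ Ioo 0 τ) := by
      rw [← Measure.prod_restrict, Measure.restrict_univ]
    rw [this]
    exact hG.restrict _
  set p : ℝ → ℝ := fun t => ∫ x, inner ℝ (G (x, t)) (D (x, t)) ∂μ with hp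
  have hpi : Integrable p ν := (integrable_inner_of_memLp_two hGν hD).integral_prod_right
  have hlt : ∀ᶠ r : ℝ in 𝓝[>] 0, r < r₀ := nhdsWithin_le_nhds (Iio_mem_nhds hr₀)
  filter_upwards [self_mem_nhdsWithin, hlt] with r hr hrr
  have hr0 : (0 : ℝ) < r := hr
  have hw := continuous_integral_window hβi r
  have hwi : Integrable (fun t => ∫ σ in (t - r)..t, β σ) ν :=
    (hw.integrableOn_Icc (a := 0) (b := τ)).mono_set Ioo_subset_Icc_self
  have hm1 : Integrable (fun t => r * (p t + c⁻¹ * β t + 3 * c * κ t)) ν :=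
    ((hpi.add (hβi.integrableOn.const_mul _)).add (hκ1.const_mul _)).const_mul _
  -- An explicit integrable majorant in `t` avoids any integrability claim for the window integral,
  -- in which `G` and `D` are taken at different times.
  refine ⟨fun t => r * (p t + c⁻¹ * β t + 3 * c * κ t) + c⁻¹ * ∫ σ in (t - r)..t, β σ,
    hm1.add (hwi.const_mul _), ?_, ?_⟩
  · have hRν : ∀ᵐ t ∂ν, MemLp (fun x => G (x, t) - γ (x, t)) 2 μ :=
      ae_restrict_of_ae (memLp_two_slice hR)
    filter_upwards [memLp_two_slice hD, memLp_two_slice hGν, hRν, hκi.prod_left_ae]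
      with t hDt hGt hRt hκt
    have hbound : ∀ᵐ σ ∂(volume.restrict (Icc (t - r) t)),
        ∫ x, inner ℝ (G (x, σ)) (D (x, t)) ∂μ ≤
          (p t + c⁻¹ * β t + 3 * c * κ t) + c⁻¹ * β σ := by
      filter_upwards [ae_restrict_of_ae (memLp_two_slice hG),
        ae_restrict_of_ae (memLp_two_slice hR), ae_restrict_mem measurableSet_Icc]
        with σ hGσ hRσ hσ
      have i1 := integrable_inner_of_memLp_two hGt hDt
      have i2 := ((memLp_two_iff_integrable_sq_norm hRt.1).1 hRt).const_mul c⁻¹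
      have i3 := hκt.const_mul (3 * c)
      have i4 : Integrable (fun x => c⁻¹ * ‖G (x, σ) - γ (x, σ)‖ ^ 2) μ :=
        ((memLp_two_iff_integrable_sq_norm hRσ.1).1 hRσ).const_mul c⁻¹
      -- `G(σ) = G(t) + (γ(t) - G(t)) + (γ(σ) - γ(t)) + (G(σ) - γ(σ))`; Young's inequality and the
      -- uniform continuity of `γ` bound each of the three errors at the price of at most `c (1 +
      -- ‖D‖²)`.
      have hpt : ∀ x, inner ℝ (G (x, σ)) (D (x, t)) ≤ inner ℝ (G (x, t)) (D (x, t)) +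
          c⁻¹ * ‖G (x, t) - γ (x, t)‖ ^ 2 + 3 * c * (1 + ‖D (x, t)‖ ^ 2) +
          c⁻¹ * ‖G (x, σ) - γ (x, σ)‖ ^ 2 := by
        intro x
        have d1 := inner_le_of_norm (γ (x, t) - G (x, t)) (D (x, t)) hc0
        have d2 := inner_le_of_norm (G (x, σ) - γ (x, σ)) (D (x, t)) hc0
        have d3 : inner ℝ (γ (x, σ) - γ (x, t)) (D (x, t)) ≤ c * (1 + ‖D (x, t)‖ ^ 2) := by
          refine (real_inner_le_norm _ _).trans ?_
          have hdist : dist (x, σ) (x, t) < r₀ := by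
            rw [Prod.dist_eq, dist_self, Real.dist_eq, abs_sub_comm, abs_of_nonneg
              (by linarith [hσ.2])]
            exact max_lt hr₀ (by linarith [hσ.1])
          have h := (huc hdist).le
          rw [dist_eq_norm] at h
          calc ‖γ (x, σ) - γ (x, t)‖ * ‖D (x, t)‖ ≤ c * ‖D (x, t)‖ :=
                mul_le_mul_of_nonneg_right h (norm_nonneg _)
            _ ≤ _ := mul_le_mul_of_nonneg_left (by nlinarith [sq_nonneg (‖D (x, t)‖ - 1)]) hc0.le
        rw [norm_sub_rev] at d1
        simp only [inner_sub_left] at d1 d2 d3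
        nlinarith
      refine (integral_mono (integrable_inner_of_memLp_two hGσ hDt) (((i1.add i2).add i3).add i4)
        hpt).trans (le_of_eq ?_)
      refine (integral_add ((i1.add i2).add i3) i4).trans ?_
      rw [integral_add' (i1.add i2) i3, integral_add' i1 i2,
        integral_const_mul, integral_const_mul, integral_const_mul]
    have hfi := integrable_flux hG hG0 hDt
    have hrt : t - r ≤ t := by linarith
    refine (intervalIntegral.integral_mono_ae_restrict hrt hfi.intervalIntegrable
      (intervalIntegrable_const.add (hβi.intervalIntegrable.const_mul c⁻¹)) hbound).trans
      (le_of_eq ?_)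
    rw [intervalIntegral.integral_add intervalIntegrable_const
      (hβi.intervalIntegrable.const_mul c⁻¹), intervalIntegral.integral_const,
      intervalIntegral.integral_const_mul, smul_eq_mul]
    ring
  · have j1 : ∫ t, β t ∂ν ≤ c * δ / 4 :=
      (setIntegral_le_integral hβi (Eventually.of_forall hβ0)).trans hb
    have j2 : ∫ t, (∫ σ in (t - r)..t, β σ) ∂ν ≤ r * (c * δ / 4) := by
      have := integral_integral_window_le hβi hβ0 hτ hr0.le
      rw [intervalIntegral.integral_of_le hτ, integral_Ioc_eq_integral_Ioo] at this
      exact this.trans (mul_le_mul_of_nonneg_left hb hr0.le)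
    have hsum : ∫ t, (p t + c⁻¹ * β t + 3 * c * κ t) ∂ν =
        ((∫ t, p t ∂ν) + c⁻¹ * ∫ t, β t ∂ν) + 3 * c * k := by
      refine (integral_add (hpi.add (hβi.integrableOn.const_mul c⁻¹))
        (hκ1.const_mul (3 * c))).trans ?_
      rw [integral_add' hpi (hβi.integrableOn.const_mul c⁻¹), integral_const_mul,
        integral_const_mul]
    rw [integral_add hm1 (hwi.const_mul _), integral_const_mul, integral_const_mul, hsum]
    have q1 : c⁻¹ * ∫ t, β t ∂ν ≤ δ / 4 := by
      refine (mul_le_mul_of_nonneg_left j1 (inv_nonneg.2 hc0.le)).trans (le_of_eq ?_)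
      field_simp
    have q2 : c⁻¹ * ∫ t, (∫ σ in (t - r)..t, β σ) ∂ν ≤ r * (δ / 4) := by
      refine (mul_le_mul_of_nonneg_left j2 (inv_nonneg.2 hc0.le)).trans (le_of_eq ?_)
      field_simp
    have q3 : 3 * c * k ≤ δ / 2 := by
      rw [hc]
      rw [mul_div_assoc', div_mul_eq_mul_div, div_le_iff₀ (by positivity)]
      nlinarith
    calc r * (((∫ t, p t ∂ν) + c⁻¹ * ∫ t, β t ∂ν) + 3 * c * k) +
          c⁻¹ * ∫ t, (∫ σ in (t - r)..t, β σ) ∂ν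
        ≤ r * (((∫ t, p t ∂ν) + δ / 4) + δ / 2) + r * (δ / 4) := by gcongr
      _ = r * ((∫ t, p t ∂ν) + δ) := by ring

/-! ### The one-sided chain rule in time. -/

section Energy

variable {N : ℕ} {Ω : Set (Space N)} {T : ℝ} {u g₀ : Space N × ℝ → ℝ} {g : Space N × ℝ → Space N}

/-- `Ψ` is Lipschitz and the measure finite, so L² continuity of `U` implies L¹ continuity of
`Ψ(U)`. -/
theorem continuous_integral_comp {X : Type*} [MeasurableSpace X] {μ : Measure X}
    [IsFiniteMeasure μ] {U : ℝ → Lp ℝ 2 μ} (hU : Continuous U) {Ψ : ℝ → ℝ} {B : ℝ}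
    (hΨi : ∀ t, Integrable (fun x => Ψ (U t x)) μ)
    (hΨ : ∀ a b, |Ψ a - Ψ b| ≤ B * |a - b|) : Continuous fun t => ∫ x, Ψ (U t x) ∂μ := by
  have hB : 0 ≤ B := by simpa using (abs_nonneg _).trans (hΨ 1 0)
  have key : ∀ t s, ‖(∫ x, Ψ (U t x) ∂μ) - ∫ x, Ψ (U s x) ∂μ‖ ≤
      B * (‖U t - U s‖ * (eLpNorm (fun _ : X => (1 : ℝ)) 2 μ).toReal) := by
    intro t s
    have hd : MemLp (fun x => U t x - U s x) 2 μ := (Lp.memLp _).sub (Lp.memLp _)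
    rw [← integral_sub (hΨi t) (hΨi s)]
    have h1 : ‖∫ x, (Ψ (U t x) - Ψ (U s x)) ∂μ‖ ≤ ∫ x, B * |U t x - U s x| ∂μ :=
      norm_integral_le_of_norm_le ((hd.integrable (by norm_num)).abs.const_mul B)
        (Eventually.of_forall fun x => hΨ _ _)
    refine h1.trans ?_
    rw [integral_const_mul]
    refine mul_le_mul_of_nonneg_left ?_ hB
    have h2 := abs_integral_inner_le hd.norm (memLp_const (1 : ℝ) (μ := μ) (p := 2))
    have h3 : eLpNorm (fun x => ‖U t x - U s x‖) 2 μ = eLpNorm (U t - U s : Lp ℝ 2 μ) 2 μ := by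
      rw [eLpNorm_norm]
      exact eLpNorm_congr_ae (Lp.coeFn_sub _ _).symm
    rw [h3, ← Lp.norm_def] at h2
    refine le_trans (le_trans (le_of_eq ?_) (le_abs_self _)) h2
    simp
  rw [continuous_iff_continuousAt]
  intro s
  rw [ContinuousAt, tendsto_iff_norm_sub_tendsto_zero]
  refine squeeze_zero (fun _ => norm_nonneg _) (fun t => key t s) ?_
  have : Continuous fun t => B * (‖U t - U s‖ * (eLpNorm (fun _ : X => (1 : ℝ)) 2 μ).toReal) := by
    fun_prop
  simpa using this.tendsto s

/-- The chain rule inequality for the time derivative, tested with a nondecreasing bounded function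
of the solution. -/
theorem integral_comp_le_integral_flux
    (hΩb : Bornology.IsBounded Ω) (hu : MemLp u 2 (cylMeasure Ω T))
    (htd : HasTimeDerivative Ω T u g₀ g) {U : ℝ → Lp ℝ 2 (volume.restrict Ω)} (hUc : Continuous U)
    (hU0 : ∀ t ≤ 0, U t = 0)
    (hUu : ∀ᵐ t ∂(volume.restrict (Ioo 0 T)), (fun x => u (x, t)) =ᵐ[volume.restrict Ω] U t)
    {Ψ ψ : ℝ → ℝ} {B : ℝ} (hd : ∀ s, HasDerivAt Ψ (ψ s) s) (hm : Monotone ψ)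
    (hB : ∀ s, |ψ s| ≤ B) (hΨ0 : Ψ 0 = 0) {Dφ : Space N × ℝ → Space N}
    (hφ : MemL2W012 Ω T (fun z => ψ (u z)) Dφ) {τ : ℝ} (hτ : 0 < τ) (hτT : τ < T) :
    ∫ x in Ω, Ψ (U τ x) ≤ ∫ t in Ioo 0 τ, ∫ x in Ω,
      inner ℝ (fluxExt T g₀ g (x, t)) (WithLp.toLp 2 (ψ (u (x, t)), Dφ (x, t))) := by
  have : IsFiniteMeasure (volume.restrict Ω) := ⟨by
    rw [Measure.restrict_apply_univ]; exact hΩb.measure_lt_top⟩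
  have hG := memLp_fluxExt htd.1 htd.2.1
  have hsub : Ioo 0 τ ⊆ Ioo 0 T := Ioo_subset_Ioo_right hτT.le
  have hνle : (volume.restrict (Ioo 0 τ) : Measure ℝ) ≤ volume.restrict (Ioo 0 T) :=
    Measure.restrict_mono hsub le_rfl
  have hD : MemLp (fun z => WithLp.toLp 2 (ψ (u z), Dφ z)) 2
      ((volume.restrict Ω).prod (volume.restrict (Ioo 0 τ))) := by
    have h1 := memLp_two_pair hφ.1 hφ.2.1
    refine h1.mono_measure ?_
    rw [Measure.prod_restrict]
    exact Measure.restrict_mono (prod_mono le_rfl hsub) le_rfl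
  have hlip : ∀ a b, |Ψ a - Ψ b| ≤ B * |a - b| := fun a b => by
    have := convex_univ.norm_image_sub_le_of_norm_hasDerivWithin_le (f := Ψ) (f' := ψ) (C := B)
      (fun x _ => (hd x).hasDerivWithinAt) (fun x _ => hB x) (mem_univ b) (mem_univ a)
    simpa using this
  have hΨc : Continuous Ψ := continuous_iff_continuousAt.2 fun s => (hd s).continuousAt
  have hUm : ∀ r, MemLp (U r) 2 (volume.restrict Ω) := fun r => Lp.memLp _
  have hΨi : ∀ t, Integrable (fun x => Ψ (U t x)) (volume.restrict Ω) := fun t => by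
    refine (((hUm t).integrable (by norm_num)).norm.const_mul B).mono'
      (hΨc.comp_aestronglyMeasurable (hUm t).1) (Eventually.of_forall fun x => ?_)
    simpa [hΨ0] using hlip (U t x) 0
  set e : ℝ → ℝ := fun t => ∫ x in Ω, Ψ (U t x) with he
  have hec : Continuous e := continuous_integral_comp hUc hΨi hlip
  have he0 : ∀ t ≤ 0, e t = 0 := fun t ht => by
    have : ∫ x in Ω, Ψ (U t x) = ∫ x in Ω, 0 := by
      refine integral_congr_ae ?_
      rw [hU0 t ht]
      filter_upwards [Lp.coeFn_zero ℝ 2 (volume.restrict Ω)] with x hx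
      rw [hx]; simpa using hΨ0
    simp only [he, this, integral_zero]
  -- The tangent inequality at `u(t)`, integrated over Ω, bounds the increment by `U(t) - U(t-r)`
  -- paired with the fixed W₀^{1,2} function `ψ(u(t))`. For `t < r` the extension by zero to
  -- negative times applies.
  have hinc : ∀ r, 0 < r → ∀ᵐ t ∂(volume.restrict (Ioo 0 τ)), e t - e (t - r) ≤
      ∫ σ in (t - r)..t, ∫ x in Ω, inner ℝ (fluxExt T g₀ g (x, σ))
        (WithLp.toLp 2 (ψ (u (x, t)), Dφ (x, t))) := by
    intro r hr
    filter_upwards [ae_mono hνle hUu, ae_mono hνle hφ.2.2, ae_restrict_mem measurableSet_Ioo]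
      with t hUt hφt ht
    rw [← integral_sub_mul_eq hΩb hu htd hUc hU0 hUu hφt (by linarith : t - r ≤ t)
      (ht.2.trans hτT), ← integral_sub (hΨi t) (hΨi (t - r))]
    refine integral_mono_ae ((hΨi t).sub (hΨi (t - r)))
      (((hUm t).sub (hUm (t - r))).integrable_mul hφt.1) ?_
    filter_upwards [hUt] with x hx
    have := sub_le_mul_sub_of_monotone_deriv hd hm (U t x) (U (t - r) x)
    rw [hx, mul_comm]
    exact this
  -- Integrating the increments over `(0,τ)` telescopes to the integral of `e` over `(τ-r,τ)`, as `e
  -- = 0` before time 0. This is at most `r(P+δ)`, yet continuity of `e` at `τ` makes it at least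
  -- `r(P+2δ)`, with `δ` a third of the supposed gap.
  by_contra! hlt
  set P := ∫ t in Ioo 0 τ, ∫ x in Ω,
      inner ℝ (fluxExt T g₀ g (x, t)) (WithLp.toLp 2 (ψ (u (x, t)), Dφ (x, t))) with hP
  set δ : ℝ := (e τ - P) / 3 with hδ
  have hlt' : P < e τ := hlt
  have hδ0 : 0 < δ := by rw [hδ]; linarith
  have hnear : ∀ᶠ t in 𝓝 τ, P + 2 * δ < e t :=
    continuousAt_const.eventually_lt hec.continuousAt (by rw [hδ]; linarith)
  obtain ⟨r₁, hr₁, hnear'⟩ := Metric.eventually_nhds_iff.1 hnear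
  have hlt₁ : ∀ᶠ r : ℝ in 𝓝[>] 0, r < r₁ := nhdsWithin_le_nhds (Iio_mem_nhds hr₁)
  obtain ⟨r, ⟨m, hmi, hmle, hmint⟩, hr, hrr⟩ :=
    ((eventually_integral_window_flux_le hG fluxExt_eq_zero hτ.le hD hδ0).and
      (Filter.Eventually.and self_mem_nhdsWithin hlt₁)).exists
  have hr0 : (0 : ℝ) < r := hr
  have hshift : Continuous fun t => e t - e (t - r) := by fun_prop
  have hup : ∫ t in (τ - r)..τ, e t ≤ r * (P + δ) := by
    have h1 : ∫ t in Ioo 0 τ, (e t - e (t - r)) ≤ ∫ t in Ioo 0 τ, m t := by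
      refine integral_mono_ae
        ((hshift.integrableOn_Icc (a := 0) (b := τ)).mono_set Ioo_subset_Icc_self) hmi ?_
      filter_upwards [hinc r hr0, hmle] with t h1 h2
      exact h1.trans h2
    have h2 := integral_sub_translate hec τ r
    rw [intervalIntegral.integral_of_le hτ.le, integral_Ioc_eq_integral_Ioo] at h2
    have h3 : ∫ t in (-r)..0, e t = 0 := by
      rw [intervalIntegral.integral_of_le (by linarith)]
      exact setIntegral_eq_zero_of_forall_eq_zero fun t ht => he0 t ht.2
    rw [h3, sub_zero] at h2
    rw [← h2]
    exact h1.trans hmint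
  have hlow : r * (P + 2 * δ) ≤ ∫ t in (τ - r)..τ, e t := by
    have := intervalIntegral.integral_mono_on (μ := volume) (by linarith : τ - r ≤ τ)
      ((continuous_const (y := P + 2 * δ)).intervalIntegrable _ _)
      (hec.intervalIntegrable _ _) (fun t ht => (hnear' (by
        rw [Real.dist_eq, abs_sub_comm, abs_of_nonneg (by linarith [ht.2])]
        linarith [ht.1])).le)
    rw [intervalIntegral.integral_const, smul_eq_mul, sub_sub_cancel] at this
    exact this
  nlinarith

end Energy

/-! ### Admissible test functions: composition and cut-off in time. -/

theorem memW012_zero {N : ℕ} (Ω : Set (Space N)) : MemW012 Ω (fun _ => 0) (fun _ => 0) := by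
  refine ⟨MemLp.zero, MemLp.zero, fun _ _ => 0, fun j => ⟨contDiff_const, HasCompactSupport.zero,
    ?_⟩, ?_, ?_⟩
  · rw [show (fun _ : Space N => (0 : ℝ)) = 0 from rfl, tsupport_zero]
    exact empty_subset _
  · simp
  · have : ∀ x : Space N, gradient (fun _ : Space N => (0 : ℝ)) x = 0 := fun x => by
      simp [gradient]
    simp [this]

section Composition

variable {N : ℕ} {Ω : Set (Space N)} {T : ℝ} {v : Space N × ℝ → ℝ} {Dv : Space N × ℝ → Space N}

/-- The chain rule in `L²(0,T; W₀^{1,2}(Ω))`. -/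
theorem MemL2W012.comp (hv : MemL2W012 Ω T v Dv) {θ θ' : ℝ → ℝ} (hθ : ContDiff ℝ ∞ θ)
    (hd : ∀ s, HasDerivAt θ (θ' s) s) (h0 : θ 0 = 0) {K : ℝ} (hK : ∀ s, |θ' s| ≤ K) :
    MemL2W012 Ω T (fun z => θ (v z)) (fun z => θ' (v z) • Dv z) := by
  have hlip : ∀ a b, |θ a - θ b| ≤ K * |a - b| := fun a b => by
    have := convex_univ.norm_image_sub_le_of_norm_hasDerivWithin_le (f := θ) (f' := θ') (C := K)
      (fun x _ => (hd x).hasDerivWithinAt) (fun x _ => hK x) (mem_univ b) (mem_univ a)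
    simpa using this
  have hθ'c : Continuous θ' := by
    have : θ' = deriv θ := funext fun s => (hd s).deriv.symm
    rw [this]; exact hθ.continuous_deriv (by simp)
  refine ⟨?_, ?_, ?_⟩
  · refine hv.1.of_le_mul (c := K) (hθ.continuous.comp_aestronglyMeasurable hv.1.1)
      (Eventually.of_forall fun x => ?_)
    simpa [h0] using hlip (v x) 0
  · refine hv.2.1.of_le_mul (c := K) ((hθ'c.comp_aestronglyMeasurable hv.1.1).smul hv.2.1.1)
      (Eventually.of_forall fun x => ?_)
    rw [norm_smul]
    exact mul_le_mul_of_nonneg_right (hK _) (norm_nonneg _)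
  · filter_upwards [hv.2.2] with t ht
    exact ht.comp hθ hd h0 hK

/-- Membership involves no regularity in time, so a sharp cut-off is harmless: each slice is kept or
replaced by zero. -/
theorem MemL2W012.indicator_lt (hv : MemL2W012 Ω T v Dv) (τ : ℝ) :
    MemL2W012 Ω T ({z | z.2 < τ}.indicator v) ({z | z.2 < τ}.indicator Dv) := by
  have hS : MeasurableSet {z : Space N × ℝ | z.2 < τ} := measurableSet_lt measurable_snd
    measurable_const
  refine ⟨hv.1.indicator hS, hv.2.1.indicator hS, ?_⟩
  filter_upwards [hv.2.2] with t ht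
  by_cases h : t < τ
  · have e1 : ∀ x : Space N, (x, t) ∈ {z : Space N × ℝ | z.2 < τ} := fun x => h
    simpa only [indicator_of_mem (e1 _)] using ht
  · have e1 : ∀ x : Space N, (x, t) ∉ {z : Space N × ℝ | z.2 < τ} := fun x => h
    simpa only [indicator_of_notMem (e1 _)] using memW012_zero Ω

end Composition

/-- Integrals over `Ω × (0,τ)`. -/
theorem integral_indicator_lt {N : ℕ} {Ω : Set (Space N)} {T τ : ℝ} (hτ : τ ≤ T)
    {k : Space N × ℝ → ℝ} (hk : Integrable k (cylMeasure Ω T)) :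
    ∫ z, {z : Space N × ℝ | z.2 < τ}.indicator k z ∂(cylMeasure Ω T) =
      ∫ t in Ioo 0 τ, ∫ x in Ω, k (x, t) := by
  have hS : MeasurableSet {z : Space N × ℝ | z.2 < τ} := measurableSet_lt measurable_snd
    measurable_const
  have h1 := hk.indicator hS
  rw [cylMeasure_eq_prod] at h1 ⊢
  rw [integral_prod_symm _ h1]
  have h2 : ∀ t, ∫ x in Ω, {z : Space N × ℝ | z.2 < τ}.indicator k (x, t) =
      (Iio τ).indicator (fun t => ∫ x in Ω, k (x, t)) t := by
    intro t
    by_cases h : t < τ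
    · have e1 : ∀ x : Space N, (x, t) ∈ {z : Space N × ℝ | z.2 < τ} := fun x => h
      simp only [indicator_of_mem (e1 _), indicator_of_mem (mem_Iio.2 h)]
    · have e1 : ∀ x : Space N, (x, t) ∉ {z : Space N × ℝ | z.2 < τ} := fun x => h
      have e2 : t ∉ Iio τ := h
      simp only [indicator_of_notMem (e1 _), indicator_of_notMem e2, integral_zero]
  simp only [h2]
  rw [setIntegral_indicator measurableSet_Iio]
  congr 2
  ext t
  simp only [mem_inter_iff, mem_Ioo, mem_Iio]
  constructor
  · rintro ⟨⟨h1, -⟩, h2⟩; exact ⟨h1, h2⟩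
  · rintro ⟨h1, h2⟩; exact ⟨⟨h1, h2.trans_le hτ⟩, h2⟩

/-- Constant extension beyond `[0,T]`; the zero initial datum makes it vanish at all negative times.
-/
theorem ContinuousInL2WithZeroInitialDatum.exists_continuous {N : ℕ} {Ω : Set (Space N)} {T : ℝ}
    (hT : 0 < T) {u : Space N × ℝ → ℝ} (hu : ContinuousInL2WithZeroInitialDatum Ω T u) :
    ∃ U : ℝ → Lp ℝ 2 (volume.restrict Ω), Continuous U ∧ (∀ t ≤ 0, U t = 0) ∧
      ∀ᵐ t ∂(volume.restrict (Ioo 0 T)), (fun x => u (x, t)) =ᵐ[volume.restrict Ω] U t := by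
  obtain ⟨U, hUc, hU0, hUu⟩ := hu
  refine ⟨IccExtend hT.le ((Icc 0 T).domRestrict U), hUc.domRestrict.Icc_extend', fun t ht => ?_, ?_⟩
  · rw [IccExtend_of_le_left hT.le _ ht]
    exact hU0
  · filter_upwards [hUu, ae_restrict_mem measurableSet_Ioo] with t h1 h2
    rw [IccExtend_of_mem hT.le _ (Ioo_subset_Icc_self h2)]
    exact h1

/-! ### Energy estimate and integrability of `G(u)`. -/

section Estimate

variable {N : ℕ} {Ω : Set (Space N)} {T : ℝ} {h η ψ Ψ G : ℝ → ℝ} {α β B L : ℝ}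
  {E : Space N × ℝ → Space N} {f : Space N × ℝ → ℝ}
  {M : Space N × ℝ → Matrix (Fin N) (Fin N) ℝ} {b : Space N × ℝ → ℝ}
  {E' : Space N × ℝ → Space N} {f' u : Space N × ℝ → ℝ}

/-- The energy estimate on `Ω × (0,τ)`. -/
theorem IsWeakSolution.energy_estimate (hΩb : Bornology.IsBounded Ω) (hT : 0 < T) (hα : 0 < α)
    (hE : MemLp E 2 (cylMeasure Ω T)) (hf : Integrable f (cylMeasure Ω T))
    (hψs : ContDiff ℝ ∞ ψ) (hdψ : ∀ s, HasDerivAt ψ (η s ^ 2) s)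
    (hdΨ : ∀ s, HasDerivAt Ψ (ψ s) s) (hψ0 : ψ 0 = 0) (hΨ0 : Ψ 0 = 0)
    (hGs : ContDiff ℝ ∞ G) (hdG : ∀ s, HasDerivAt G (η s) s) (hG0 : G 0 = 0) (hη : ∀ s, 0 < η s)
    (hηh : ∀ s, η s * (|h s| + 1) ≤ 1) (hB : ∀ s, |ψ s| ≤ B) (hL : 0 ≤ L)
    (hM : IsElliptic Ω T α β M) (hE' : ∀ᵐ z ∂(cylMeasure Ω T), ‖E' z‖ ≤ ‖E z‖)
    (hf' : ∀ᵐ z ∂(cylMeasure Ω T), |f' z| ≤ |f z|) (hb : ∀ z, |b z| ≤ L * (|h (u z)| + 1))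
    (hu : IsWeakSolution Ω T M (fun z => b z • E' z) f' u) :
    ∃ Du : Space N × ℝ → Space N, MemL2W012 Ω T u Du ∧
      ∀ᵐ τ ∂(volume.restrict (Ioo 0 T)), (∫ x in Ω, Ψ (u (x, τ))) +
        α / 2 * ∫ z, {z : Space N × ℝ | z.2 < τ}.indicator (fun z => ‖η (u z) • Du z‖ ^ 2) z
          ∂(cylMeasure Ω T) ≤
        L ^ 2 / (2 * α) * (∫ z, ‖E z‖ ^ 2 ∂(cylMeasure Ω T)) + B * ∫ z, |f z| ∂(cylMeasure Ω T) := by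
  obtain ⟨Du, g₀, g, hDu, htd, hcont, hweak⟩ := hu
  obtain ⟨U, hUc, hU0, hUu⟩ := hcont.exists_continuous hT
  refine ⟨Du, hDu, ?_⟩
  have hη1 : ∀ s, η s ≤ 1 := fun s => by nlinarith [hηh s, hη s, abs_nonneg (h s)]
  have hφ : MemL2W012 Ω T (fun z => ψ (u z)) (fun z => η (u z) ^ 2 • Du z) :=
    hDu.comp hψs hdψ hψ0 (K := 1) fun s => by
      rw [abs_of_nonneg (sq_nonneg _)]
      exact pow_le_one₀ (hη s).le (hη1 s)
  have hG : MemL2W012 Ω T (fun z => G (u z)) (fun z => η (u z) • Du z) :=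
    hDu.comp hGs hdG hG0 (K := 1) fun s => by
      rw [abs_of_nonneg (hη s).le]
      exact hη1 s
  have hmono : Monotone ψ := monotone_of_deriv_nonneg (fun s => (hdψ s).differentiableAt)
    fun s => by rw [(hdψ s).deriv]; positivity
  filter_upwards [hUu, ae_restrict_mem measurableSet_Ioo] with τ hUτ hτ
  set S : Set (Space N × ℝ) := {z | z.2 < τ} with hS
  have hSm : MeasurableSet S := measurableSet_lt measurable_snd measurable_const
  -- The test function is `ψ(u)` cut off at time `τ`. Its gradient `η(u)² Du` pairs with `Du` to
  -- give `|∇G(u)|²` through ellipticity.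
  obtain ⟨i1, i2, i3, heq⟩ := hweak _ _ (hφ.indicator_lt τ)
  have hk : Integrable (fun z => g₀ z * ψ (u z) + inner ℝ (g z) (η (u z) ^ 2 • Du z))
      (cylMeasure Ω T) :=
    (htd.1.integrable_mul hφ.1).add (integrable_inner_of_memLp_two htd.2.1 hφ.2.1)
  have htime := integral_comp_le_integral_flux hΩb hDu.1 htd hUc hU0 hUu hdΨ hmono hB hΨ0 hφ
    hτ.1 hτ.2
  have e1 : ∫ x in Ω, Ψ (U τ x) = ∫ x in Ω, Ψ (u (x, τ)) := by
    refine integral_congr_ae ?_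
    filter_upwards [hUτ] with x hx
    rw [hx]
  have e2 : ∫ t in Ioo 0 τ, ∫ x in Ω, inner ℝ (fluxExt T g₀ g (x, t))
      (WithLp.toLp 2 (ψ (u (x, t)), η (u (x, t)) ^ 2 • Du (x, t))) =
      ∫ z, (g₀ z * S.indicator (fun z => ψ (u z)) z +
        inner ℝ (g z) (S.indicator (fun z => η (u z) ^ 2 • Du z) z)) ∂(cylMeasure Ω T) := by
    have e3 : ∀ z, g₀ z * S.indicator (fun z => ψ (u z)) z +
        inner ℝ (g z) (S.indicator (fun z => η (u z) ^ 2 • Du z) z) =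
        S.indicator (fun z => g₀ z * ψ (u z) + inner ℝ (g z) (η (u z) ^ 2 • Du z)) z := by
      intro z
      by_cases hz : z ∈ S
      · simp only [indicator_of_mem hz]
      · simp only [indicator_of_notMem hz, mul_zero, inner_zero_right, add_zero]
    simp only [e3]
    rw [integral_indicator_lt hτ.2.le hk]
    refine setIntegral_congr_fun measurableSet_Ioo fun t ht => ?_
    refine integral_congr_ae (Eventually.of_forall fun x => ?_)
    simp only [fluxExt_eq (x, t) ⟨ht.1, ht.2.trans hτ.2⟩, inner_pair]
  rw [e1, e2] at htime
  set w : Space N × ℝ → ℝ := fun z => ‖η (u z) • Du z‖ ^ 2 with hw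
  have hwi : Integrable (S.indicator w) (cylMeasure Ω T) :=
    ((memLp_two_iff_integrable_sq_norm hG.2.1.1).1 hG.2.1).indicator hSm
  have hEi : Integrable (fun z => ‖E z‖ ^ 2) (cylMeasure Ω T) :=
    (memLp_two_iff_integrable_sq_norm hE.1).1 hE
  have hwz : ∀ z, w z = η (u z) ^ 2 * ‖Du z‖ ^ 2 := fun z => by
    simp only [hw, norm_smul, mul_pow, Real.norm_eq_abs, sq_abs]
  have ineq1 : α * ∫ z, S.indicator w z ∂(cylMeasure Ω T) ≤
      ∫ z, inner ℝ (Matrix.toEuclideanLin (M z) (Du z))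
        (S.indicator (fun z => η (u z) ^ 2 • Du z) z) ∂(cylMeasure Ω T) := by
    rw [← integral_const_mul]
    refine integral_mono_ae (hwi.const_mul α) i1 ?_
    filter_upwards [hM.2] with z hz
    by_cases hzS : z ∈ S
    · simp only [indicator_of_mem hzS, inner_smul_right, hwz]
      have := mul_le_mul_of_nonneg_left (hz (Du z)).1 (sq_nonneg (η (u z)))
      linarith
    · simp only [indicator_of_notMem hzS, inner_zero_right, mul_zero, le_refl]
  have ineq2 : ∫ z, inner ℝ (b z • E' z) (S.indicator (fun z => η (u z) ^ 2 • Du z) z)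
      ∂(cylMeasure Ω T) ≤ α / 2 * (∫ z, S.indicator w z ∂(cylMeasure Ω T)) +
        L ^ 2 / (2 * α) * ∫ z, ‖E z‖ ^ 2 ∂(cylMeasure Ω T) := by
    rw [← integral_const_mul, ← integral_const_mul,
      ← integral_add (hwi.const_mul _) (hEi.const_mul _)]
    refine integral_mono_ae i2 ((hwi.const_mul _).add (hEi.const_mul _)) ?_
    filter_upwards [hE'] with z hz
    have hpos : 0 ≤ L ^ 2 / (2 * α) * ‖E z‖ ^ 2 := by positivity
    by_cases hzS : z ∈ S
    · simp only [indicator_of_mem hzS, inner_smul_right, inner_smul_left, hwz,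
        conj_trivial]
      set y := η (u z) * ‖Du z‖ with hy
      have hy0 : 0 ≤ y := mul_nonneg (hη _).le (norm_nonneg _)
      -- One factor `η` of the gradient `η² Du` cancels the growth of the drift coefficient; the
      -- other stays with `Du` to form `y = |∇G(u)|`.
      have a1 : |b z| * η (u z) ≤ L := by
        calc |b z| * η (u z) ≤ L * (|h (u z)| + 1) * η (u z) :=
              mul_le_mul_of_nonneg_right (hb z) (hη _).le
          _ = L * (η (u z) * (|h (u z)| + 1)) := by ring
          _ ≤ L * 1 := mul_le_mul_of_nonneg_left (hηh _) hL
          _ = L := mul_one L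
      have a2 : b z * inner ℝ (E' z) (Du z) ≤ |b z| * (‖E z‖ * ‖Du z‖) := by
        refine (le_abs_self _).trans ?_
        rw [abs_mul]
        refine mul_le_mul_of_nonneg_left ((abs_real_inner_le_norm _ _).trans ?_) (abs_nonneg _)
        exact mul_le_mul_of_nonneg_right hz (norm_nonneg _)
      have a3 : η (u z) ^ 2 * (b z * inner ℝ (E' z) (Du z)) ≤ L * ‖E z‖ * y := by
        calc η (u z) ^ 2 * (b z * inner ℝ (E' z) (Du z))
            ≤ η (u z) ^ 2 * (|b z| * (‖E z‖ * ‖Du z‖)) :=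
              mul_le_mul_of_nonneg_left a2 (sq_nonneg _)
          _ = (|b z| * η (u z)) * (‖E z‖ * y) := by rw [hy]; ring
          _ ≤ L * (‖E z‖ * y) := mul_le_mul_of_nonneg_right a1 (by positivity)
          _ = _ := by ring
      -- Young's inequality balanced so that half of the coercive term survives.
      have a4 : L * ‖E z‖ * y ≤ α / 2 * y ^ 2 + L ^ 2 / (2 * α) * ‖E z‖ ^ 2 := by
        have : α / 2 * y ^ 2 + L ^ 2 / (2 * α) * ‖E z‖ ^ 2 - L * ‖E z‖ * y =
            (2 * α)⁻¹ * (α * y - L * ‖E z‖) ^ 2 := by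
          field_simp; ring
        have h2 : 0 ≤ (2 * α)⁻¹ * (α * y - L * ‖E z‖) ^ 2 := by positivity
        linarith
      have a5 : y ^ 2 = η (u z) ^ 2 * ‖Du z‖ ^ 2 := by rw [hy, mul_pow]
      rw [a5] at a4
      linarith
    · simp only [indicator_of_notMem hzS, inner_zero_right, mul_zero, zero_add]
      exact hpos
  have ineq3 : ∫ z, f' z * S.indicator (fun z => ψ (u z)) z ∂(cylMeasure Ω T) ≤
      B * ∫ z, |f z| ∂(cylMeasure Ω T) := by
    rw [← integral_const_mul]
    refine integral_mono_ae i3 (hf.abs.const_mul B) ?_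
    filter_upwards [hf'] with z hz
    have hB0 : 0 ≤ B := (abs_nonneg _).trans (hB 0)
    by_cases hzS : z ∈ S
    · simp only [indicator_of_mem hzS]
      refine (le_abs_self _).trans ?_
      rw [abs_mul, mul_comm]
      exact mul_le_mul (hB _) hz (abs_nonneg _) hB0
    · simp only [indicator_of_notMem hzS, mul_zero]
      positivity
  simp only at heq
  linarith

end Estimate

section Estimate

variable {N : ℕ} {Ω : Set (Space N)} {T : ℝ} {h η ψ Ψ G : ℝ → ℝ} {α β B L K : ℝ}
  {E : Space N × ℝ → Space N} {f : Space N × ℝ → ℝ}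
  {M : Space N × ℝ → Matrix (Fin N) (Fin N) ℝ} {b : Space N × ℝ → ℝ}
  {E' : Space N × ℝ → Space N} {f' u : Space N × ℝ → ℝ}

/-- Lets the gradient bound, available for a.e. `τ < T`, pass to the whole cylinder by dominated
convergence. -/
theorem tendsto_integral_indicator_lt {k : Space N × ℝ → ℝ} (hk : Integrable k (cylMeasure Ω T)) :
    Tendsto (fun τ => ∫ z, {z : Space N × ℝ | z.2 < τ}.indicator k z ∂(cylMeasure Ω T)) (𝓝[<] T)
      (𝓝 (∫ z, k z ∂(cylMeasure Ω T))) := by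
  have hS : ∀ τ, MeasurableSet {z : Space N × ℝ | z.2 < τ} := fun τ =>
    measurableSet_lt measurable_snd measurable_const
  refine tendsto_integral_filter_of_dominated_convergence (fun z => ‖k z‖)
    (Eventually.of_forall fun τ => hk.1.indicator (hS τ))
    (Eventually.of_forall fun τ => Eventually.of_forall fun z => norm_indicator_le_norm_self _ _)
    hk.norm ?_
  have hmem : ∀ᵐ z ∂(cylMeasure Ω T), z.2 < T := by
    rw [cylMeasure_eq_prod]
    refine Measure.ae_prod_iff_ae_ae (measurableSet_lt measurable_snd measurable_const) |>.2 ?_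
    refine Eventually.of_forall fun x => ?_
    filter_upwards [ae_restrict_mem measurableSet_Ioo] with t ht
    exact ht.2
  filter_upwards [hmem] with z hz
  refine tendsto_const_nhds.congr' ?_
  filter_upwards [nhdsWithin_le_nhds (Ioi_mem_nhds hz)] with τ hτ
  exact (indicator_of_mem (s := {z : Space N × ℝ | z.2 < τ}) hτ k).symm

/-- The parabolic integrability estimate for `G(u)`. -/
theorem IsWeakSolution.lintegral_pow_le (hN : 1 ≤ N) (hΩb : Bornology.IsBounded Ω) (hT : 0 < T)
    (hα : 0 < α)
    (hE : MemLp E 2 (cylMeasure Ω T)) (hf : Integrable f (cylMeasure Ω T))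
    (hψs : ContDiff ℝ ∞ ψ) (hdψ : ∀ s, HasDerivAt ψ (η s ^ 2) s)
    (hdΨ : ∀ s, HasDerivAt Ψ (ψ s) s) (hψ0 : ψ 0 = 0) (hΨ0 : Ψ 0 = 0)
    (hGs : ContDiff ℝ ∞ G) (hdG : ∀ s, HasDerivAt G (η s) s) (hG0 : G 0 = 0) (hη : ∀ s, 0 < η s)
    (hηh : ∀ s, η s * (|h s| + 1) ≤ 1) (hB : ∀ s, |ψ s| ≤ B) (hL : 0 ≤ L)
    (hK : 0 ≤ K) (hGΨ : ∀ s, G s ^ 2 ≤ K * Ψ s) {c : ℝ≥0∞}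
    (hGN : ∀ (v : Space N → ℝ) (Dv : Space N → Space N), MemW012 Ω v Dv →
      ∫⁻ x in Ω, ‖v x‖ₑ ^ (2 + 4 / (N : ℝ)) ≤
        c * (∫⁻ x in Ω, ‖v x‖ₑ ^ (2 : ℝ)) ^ (2 / (N : ℝ)) * ∫⁻ x in Ω, ‖Dv x‖ₑ ^ (2 : ℝ))
    (hM : IsElliptic Ω T α β M) (hE' : ∀ᵐ z ∂(cylMeasure Ω T), ‖E' z‖ ≤ ‖E z‖)
    (hf' : ∀ᵐ z ∂(cylMeasure Ω T), |f' z| ≤ |f z|) (hb : ∀ z, |b z| ≤ L * (|h (u z)| + 1))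
    (hu : IsWeakSolution Ω T M (fun z => b z • E' z) f' u) {R : ℝ}
    (hR : L ^ 2 / (2 * α) * (∫ z, ‖E z‖ ^ 2 ∂(cylMeasure Ω T)) +
      B * ∫ z, |f z| ∂(cylMeasure Ω T) ≤ R) :
    AEStronglyMeasurable u (cylMeasure Ω T) ∧
    ∫⁻ z, ‖G (u z)‖ₑ ^ (2 + 4 / (N : ℝ)) ∂(cylMeasure Ω T) ≤
      c * ENNReal.ofReal (K * R) ^ (2 / (N : ℝ)) * ENNReal.ofReal (2 / α * R) := by
  have : IsFiniteMeasure (volume.restrict Ω) := ⟨by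
    rw [Measure.restrict_apply_univ]; exact hΩb.measure_lt_top⟩
  have hNpos : (0 : ℝ) < N := by exact_mod_cast hN
  obtain ⟨Du, hDu, hen⟩ := hu.energy_estimate hΩb hT hα hE hf hψs hdψ hdΨ hψ0 hΨ0 hGs hdG hG0 hη
    hηh hB hL hM hE' hf' hb
  refine ⟨hDu.1.1, ?_⟩
  have hη1 : ∀ s, |η s| ≤ 1 := fun s => by
    rw [abs_of_nonneg (hη s).le]
    nlinarith [hηh s, hη s, abs_nonneg (h s)]
  have hG : MemL2W012 Ω T (fun z => G (u z)) (fun z => η (u z) • Du z) :=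
    hDu.comp hGs hdG hG0 hη1
  have hmono : Monotone ψ := monotone_of_deriv_nonneg (fun s => (hdψ s).differentiableAt)
    fun s => by rw [(hdψ s).deriv]; positivity
  have hΨnn : ∀ s, 0 ≤ Ψ s := fun s => by
    have := sub_le_mul_sub_of_monotone_deriv hdΨ hmono 0 s
    rw [hψ0, hΨ0] at this
    linarith
  set w : Space N × ℝ → ℝ := fun z => ‖η (u z) • Du z‖ ^ 2 with hw
  have hwi : Integrable w (cylMeasure Ω T) := (memLp_two_iff_integrable_sq_norm hG.2.1.1).1 hG.2.1
  have hw0 : ∀ z, 0 ≤ w z := fun z => sq_nonneg _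
  -- the two bounds contained in the energy estimate
  have hΨR : ∀ᵐ τ ∂(volume.restrict (Ioo 0 T)), ∫ x in Ω, Ψ (u (x, τ)) ≤ R := by
    filter_upwards [hen] with τ hτ
    have h1 : 0 ≤ ∫ z, {z : Space N × ℝ | z.2 < τ}.indicator w z ∂(cylMeasure Ω T) :=
      integral_nonneg fun z => indicator_nonneg (fun z _ => hw0 z) z
    have h2 : 0 ≤ α / 2 * ∫ z, {z : Space N × ℝ | z.2 < τ}.indicator w z ∂(cylMeasure Ω T) := by
      positivity
    linarith
  have hwR : ∫ z, w z ∂(cylMeasure Ω T) ≤ 2 / α * R := by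
    have h1 : ∀ᵐ τ ∂(volume.restrict (Ioo 0 T)),
        ∫ z, {z : Space N × ℝ | z.2 < τ}.indicator w z ∂(cylMeasure Ω T) ≤ 2 / α * R := by
      filter_upwards [hen] with τ hτ
      have h1 : 0 ≤ ∫ x in Ω, Ψ (u (x, τ)) := integral_nonneg fun x => hΨnn _
      have h2 : α / 2 * ∫ z, {z : Space N × ℝ | z.2 < τ}.indicator w z ∂(cylMeasure Ω T) ≤ R := by
        linarith
      calc _ = 2 / α * (α / 2 *
            ∫ z, {z : Space N × ℝ | z.2 < τ}.indicator w z ∂(cylMeasure Ω T)) := by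
            field_simp
        _ ≤ _ := by gcongr
    -- A set of full measure in `(0,T)` meets every interval `(l,T)`, so the bound holds for `τ`
    -- arbitrarily close to `T`, which is enough for the limit.
    refine le_of_tendsto_of_frequently (tendsto_integral_indicator_lt hwi) ?_
    rw [Filter.frequently_iff]
    intro V hV
    obtain ⟨l, hl, hlV⟩ := (mem_nhdsLT_iff_exists_Ioo_subset).1 hV
    have hlt : max l 0 < T := max_lt hl hT
    have hsub : Ioo (max l 0) T ⊆ Ioo 0 T := Ioo_subset_Ioo_left (le_max_right _ _)
    have h2 := ae_restrict_of_ae_restrict_of_subset hsub h1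
    have : NeBot (ae ((volume : Measure ℝ).restrict (Ioo (max l 0) T))) := by
      rw [ae_neBot, Ne, Measure.restrict_eq_zero, Real.volume_Ioo]
      simpa using hlt
    obtain ⟨τ, hτ1, hτ2⟩ := (h2.and (ae_restrict_mem measurableSet_Ioo)).exists
    exact ⟨τ, hlV ⟨(le_max_left _ _).trans_lt hτ2.1, hτ2.2⟩, hτ1⟩
  have hlw : ∫⁻ z, ‖η (u z) • Du z‖ₑ ^ (2 : ℝ) ∂(cylMeasure Ω T) ≤ ENNReal.ofReal (2 / α * R) := by
    refine le_trans (le_of_eq ?_) (ENNReal.ofReal_le_ofReal hwR)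
    rw [ofReal_integral_eq_lintegral_ofReal hwi (Eventually.of_forall hw0)]
    refine lintegral_congr fun z => ?_
    rw [hw, ENNReal.ofReal_pow (norm_nonneg _), ofReal_norm, ENNReal.rpow_ofNat]
  have hΨc : Continuous Ψ := continuous_iff_continuousAt.2 fun s => (hdΨ s).continuousAt
  have hslice : ∀ᵐ t ∂(volume.restrict (Ioo 0 T)),
      ∫⁻ x in Ω, ‖G (u (x, t))‖ₑ ^ (2 + 4 / (N : ℝ)) ≤
        c * ENNReal.ofReal (K * R) ^ (2 / (N : ℝ)) *
          ∫⁻ x in Ω, ‖η (u (x, t)) • Du (x, t)‖ₑ ^ (2 : ℝ) := by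
    filter_upwards [hG.2.2, hDu.2.2, hΨR] with t hGt hut hΨt
    refine (hGN _ _ hGt).trans ?_
    gcongr
    have hΨi : Integrable (fun x => Ψ (u (x, t))) (volume.restrict Ω) := by
      refine ((hut.1.integrable (by norm_num)).norm.const_mul B).mono'
        (hΨc.comp_aestronglyMeasurable hut.1.1) (Eventually.of_forall fun x => ?_)
      have := convex_univ.norm_image_sub_le_of_norm_hasDerivWithin_le (f := Ψ) (f' := ψ) (C := B)
        (fun x _ => (hdΨ x).hasDerivWithinAt) (fun x _ => hB x) (mem_univ 0) (mem_univ (u (x, t)))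
      simpa [hΨ0] using this
    have h1 : K * ∫ x in Ω, Ψ (u (x, t)) ≤ K * R := mul_le_mul_of_nonneg_left hΨt hK
    refine le_trans ?_ (ENNReal.ofReal_le_ofReal h1)
    rw [← integral_const_mul, ofReal_integral_eq_lintegral_ofReal (hΨi.const_mul K)
      (Eventually.of_forall fun x => mul_nonneg hK (hΨnn _))]
    refine lintegral_mono fun x => ?_
    rw [ENNReal.rpow_ofNat, ← ofReal_norm, ← ENNReal.ofReal_pow (norm_nonneg _), Real.norm_eq_abs,
      sq_abs]
    exact ENNReal.ofReal_le_ofReal (hGΨ _)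
  have hm1 : AEMeasurable (fun z => ‖G (u z)‖ₑ ^ (2 + 4 / (N : ℝ))) (cylMeasure Ω T) :=
    hG.1.1.enorm.pow_const _
  have hm2 : AEMeasurable (fun z => ‖η (u z) • Du z‖ₑ ^ (2 : ℝ)) (cylMeasure Ω T) :=
    hG.2.1.1.enorm.pow_const _
  rw [cylMeasure_eq_prod] at hm1 hm2 hlw ⊢
  rw [lintegral_prod_symm _ hm2] at hlw
  rw [lintegral_prod_symm _ hm1]
  -- The factor containing the L² norm is already uniform in `t`, so time integration acts only on
  -- the gradient term.
  refine (lintegral_mono_ae hslice).trans ?_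
  rw [lintegral_const_mul'' _ hm2.lintegral_prod_left']
  gcongr

end Estimate

/-! ### Chebyshev's inequality and the decay of the level sets. -/

theorem cylMeasure_apply {N : ℕ} {Ω : Set (Space N)} (hΩ : IsOpen Ω) (T : ℝ)
    (S : Set (Space N × ℝ)) : cylMeasure Ω T S = volume (S ∩ cyl Ω T) :=
  Measure.restrict_apply' (hΩ.measurableSet.prod measurableSet_Ioo)

/-- Chebyshev's inequality on the cylinder. -/
theorem measureReal_mul_rpow_le {N : ℕ} {Ω : Set (Space N)} (hΩo : IsOpen Ω) {T : ℝ}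
    {w : Space N × ℝ → ℝ} (hw : AEStronglyMeasurable w (cylMeasure Ω T)) {r : ℝ} (hr : 0 ≤ r)
    {A : ℝ≥0∞} (hA : A ≠ ⊤) (hle : ∫⁻ z, ‖w z‖ₑ ^ r ∂(cylMeasure Ω T) ≤ A) {m : ℝ} (hm : 0 ≤ m)
    {p : Space N × ℝ → Prop} (hp : ∀ z, p z → m ≤ 4 * |w z|) :
    volume.real {z ∈ cyl Ω T | p z} * m ^ r ≤ 4 ^ r * A.toReal := by
  have h1 : volume {z ∈ cyl Ω T | p z} * ENNReal.ofReal (m ^ r) ≤ ENNReal.ofReal (4 ^ r) * A := by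
    have hsub : volume {z ∈ cyl Ω T | p z} ≤
        cylMeasure Ω T {z | ENNReal.ofReal (m ^ r) ≤ ENNReal.ofReal (4 ^ r) * ‖w z‖ₑ ^ r} := by
      rw [cylMeasure_apply hΩo]
      refine measure_mono fun z hz => ⟨?_, hz.1⟩
      have h2 := Real.rpow_le_rpow hm (hp z hz.2) hr
      rw [Real.mul_rpow (by norm_num) (abs_nonneg _)] at h2
      have h3 := ENNReal.ofReal_le_ofReal h2
      rw [ENNReal.ofReal_mul (by positivity),
        ← ENNReal.ofReal_rpow_of_nonneg (abs_nonneg (w z)) hr, ← Real.enorm_eq_ofReal_abs] at h3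
      exact h3
    have hmeas : AEMeasurable (fun z => ENNReal.ofReal (4 ^ r) * ‖w z‖ₑ ^ r) (cylMeasure Ω T) :=
      (hw.enorm.pow_const r).const_mul _
    calc _ ≤ _ := mul_le_mul_left hsub _
      _ = _ := mul_comm _ _
      _ ≤ _ := mul_meas_ge_le_lintegral₀ hmeas _
      _ = ENNReal.ofReal (4 ^ r) * ∫⁻ z, ‖w z‖ₑ ^ r ∂(cylMeasure Ω T) :=
          lintegral_const_mul'' _ (hw.enorm.pow_const r)
      _ ≤ _ := by gcongr
  have h2 := ENNReal.toReal_mono (ENNReal.mul_ne_top ENNReal.ofReal_ne_top hA) h1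
  rwa [ENNReal.toReal_mul, ENNReal.toReal_mul, ENNReal.toReal_ofReal (by positivity),
    ENNReal.toReal_ofReal (by positivity)] at h2

/-- `H` is nondecreasing with `H(0) = 0`, so on either side of 0 a bound on `u` from below in
absolute value becomes one on `|H(u)|`. -/
theorem abs_Hfun_le {h : ℝ → ℝ} (hc : Continuous h) :
    (∀ a b : ℝ, 0 ≤ a → a ≤ b → |Hfun h a| ≤ |Hfun h b|) ∧
      ∀ a b : ℝ, a ≤ 0 → b ≤ a → |Hfun h a| ≤ |Hfun h b| := by
  have hcH : Continuous fun s => 1 / (|h s| + 1) :=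
    continuous_const.div (hc.abs.add continuous_const) fun s => by positivity
  have hnn : ∀ a b : ℝ, a ≤ b → Hfun h a ≤ Hfun h b := fun a b hab => by
    have h1 := intervalIntegral.integral_nonneg (μ := volume) hab
      (f := fun l => 1 / (|h l| + 1)) fun t _ => by positivity
    have h2 := intervalIntegral.integral_add_adjacent_intervals
      (hcH.intervalIntegrable (μ := volume) 0 a) (hcH.intervalIntegrable a b)
    simp only [Hfun]
    linarith
  have h0 : Hfun h 0 = 0 := by simp [Hfun]
  refine ⟨fun a b ha hab => ?_, fun a b ha hab => ?_⟩
  · have h1 := hnn 0 a ha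
    rw [h0] at h1
    exact abs_le_abs_of_nonneg h1 (hnn a b hab)
  · have h1 := hnn a 0 ha
    rw [h0] at h1
    exact abs_le_abs_of_nonpos h1 (hnn b a hab)

end ParabolicDecay

theorem lemma3p1 (N : ℕ) (hN : 1 ≤ N)
    (Ω : Set (ParabolicDecay.Space N)) (hΩo : IsOpen Ω) (hΩb : Bornology.IsBounded Ω)
    (T : ℝ) (hT : 0 < T)
    (h : ℝ → ℝ) (hLip : LocallyLipschitz h) (h0 : h 0 = 0)
    (hsuper : Tendsto (fun l : ℝ => |h l| / |l|) (cocompact ℝ) atTop)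
    (α : ℝ) (hα : 0 < α)
    (E : ParabolicDecay.Space N × ℝ → ParabolicDecay.Space N)
    (hE : MemLp E 2 (ParabolicDecay.cylMeasure Ω T))
    (f : ParabolicDecay.Space N × ℝ → ℝ)
    (hf : Integrable f (ParabolicDecay.cylMeasure Ω T)) :
    ∃ C : ℝ, 0 < C ∧
      ∀ (β : ℝ) (M : ParabolicDecay.Space N × ℝ → Matrix (Fin N) (Fin N) ℝ)
        (En : ℕ → ParabolicDecay.Space N × ℝ → ParabolicDecay.Space N)
        (fn : ℕ → ParabolicDecay.Space N × ℝ → ℝ)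
        (u : ℕ → ParabolicDecay.Space N × ℝ → ℝ),
        0 < β →
        ParabolicDecay.IsElliptic Ω T α β M →
        (∀ n, AEStronglyMeasurable (En n) (ParabolicDecay.cylMeasure Ω T) ∧
          ∀ᵐ z ∂(ParabolicDecay.cylMeasure Ω T), ‖En n z‖ ≤ ‖E z‖) →
        (∀ n, AEStronglyMeasurable (fn n) (ParabolicDecay.cylMeasure Ω T) ∧
          ∀ᵐ z ∂(ParabolicDecay.cylMeasure Ω T), |fn n z| ≤ |f z|) →
        ((∀ n, ParabolicDecay.IsWeakSolution Ω T M
            (fun z => h (u n z) • En n z) (fn n) (u n)) ∨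
          ((∃ L : ℝ, ∀ (m : ℕ) (s : ℝ), |h (ParabolicDecay.trunc m s)| ≤ L * (|h s| + 1)) ∧
            ∀ n, ParabolicDecay.IsWeakSolution Ω T M
              (fun z => h (ParabolicDecay.trunc n (u n z)) • En n z) (fn n) (u n))) →
        ∀ (n : ℕ) (k : ℝ), 0 ≤ k →
          volume.real {z ∈ ParabolicDecay.cyl Ω T | k < u n z} *
              |ParabolicDecay.Hfun h k| ^ (2 * ((N : ℝ) + 2) / N) ≤ C ∧
          volume.real {z ∈ ParabolicDecay.cyl Ω T | u n z < -k} *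
              |ParabolicDecay.Hfun h (-k)| ^ (2 * ((N : ℝ) + 2) / N) ≤ C ∧
          volume.real {z ∈ ParabolicDecay.cyl Ω T | k < |u n z|} *
              (min |ParabolicDecay.Hfun h k| |ParabolicDecay.Hfun h (-k)|) ^
                (2 * ((N : ℝ) + 2) / N) ≤ C := by
  have hc : Continuous h := hLip.continuous
  have hNpos : (0 : ℝ) < N := by exact_mod_cast hN
  obtain ⟨η, G, ψ, Ψ, B, K, hGs, hψs, hdG, hdψ, hdΨ, hG0, hψ0, hΨ0, hη, hηh, hB, hK, hGΨ, hHG⟩ :=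
    ParabolicDecay.exists_auxiliary_functions hc hsuper
  obtain ⟨c, hctop, hGN⟩ := ParabolicDecay.exists_lintegral_pow_le_of_memW012 N hN
  -- `L` is fixed before the matrix and the solutions are introduced, since `C` may depend only on
  -- the data. `L ≥ 1` also covers the untruncated drift; if no truncation constant exists, only
  -- that case can occur.
  obtain ⟨L, hL1, hL⟩ : ∃ L : ℝ, 1 ≤ L ∧
      ((∃ L : ℝ, ∀ (m : ℕ) (s : ℝ), |h (ParabolicDecay.trunc m s)| ≤ L * (|h s| + 1)) →
        ∀ (m : ℕ) (s : ℝ), |h (ParabolicDecay.trunc m s)| ≤ L * (|h s| + 1)) := by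
    by_cases hex : ∃ L : ℝ, ∀ (m : ℕ) (s : ℝ), |h (ParabolicDecay.trunc m s)| ≤ L * (|h s| + 1)
    · obtain ⟨L, hL⟩ := hex
      exact ⟨max L 1, le_max_right _ _, fun _ m s => (hL m s).trans
        (mul_le_mul_of_nonneg_right (le_max_left _ _) (by positivity))⟩
    · exact ⟨1, le_rfl, fun h => absurd h hex⟩
  set R : ℝ := L ^ 2 / (2 * α) * (∫ z, ‖E z‖ ^ 2 ∂(ParabolicDecay.cylMeasure Ω T)) +
    B * ∫ z, |f z| ∂(ParabolicDecay.cylMeasure Ω T) with hR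
  set A : ENNReal := c * ENNReal.ofReal (K * R) ^ (2 / (N : ℝ)) * ENNReal.ofReal (2 / α * R) with hA
  have hAtop : A ≠ ⊤ := ENNReal.mul_ne_top (ENNReal.mul_ne_top hctop
    (ENNReal.rpow_ne_top_of_nonneg (by positivity) ENNReal.ofReal_ne_top)) ENNReal.ofReal_ne_top
  have hr : 2 * ((N : ℝ) + 2) / N = 2 + 4 / (N : ℝ) := by field_simp; ring
  have hr0 : (0 : ℝ) ≤ 2 * ((N : ℝ) + 2) / N := by positivity
  -- The power of 4 comes from `|H| ≤ 4|G|`; the summand 1 only makes the constant positive.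
  refine ⟨4 ^ (2 * ((N : ℝ) + 2) / N) * A.toReal + 1, by positivity, ?_⟩
  intro β M En fn u _ hM hEn hfn hcases n k hk
  have hmain : AEStronglyMeasurable (u n) (ParabolicDecay.cylMeasure Ω T) ∧
      ∫⁻ z, ‖G (u n z)‖ₑ ^ (2 * ((N : ℝ) + 2) / N) ∂(ParabolicDecay.cylMeasure Ω T) ≤ A := by
    rw [hr]
    obtain ⟨b, hb, hsol⟩ : ∃ b : ParabolicDecay.Space N × ℝ → ℝ,
        (∀ z, |b z| ≤ L * (|h (u n z)| + 1)) ∧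
        ParabolicDecay.IsWeakSolution Ω T M (fun z => b z • En n z) (fn n) (u n) := by
      rcases hcases with hsol | ⟨hex, hsol⟩
      · exact ⟨fun z => h (u n z), fun z => by nlinarith [abs_nonneg (h (u n z))], hsol n⟩
      · exact ⟨fun z => h (ParabolicDecay.trunc n (u n z)), fun z => hL hex n _, hsol n⟩
    exact hsol.lintegral_pow_le hN hΩb hT hα hE hf hψs hdψ hdΨ hψ0 hΨ0 hGs hdG hG0 hη hηh hB
      (zero_le_one.trans hL1) hK hGΨ (hGN Ω) hM (hEn n).2 (hfn n).2 hb hR.ge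
  have hGm : AEStronglyMeasurable (fun z => G (u n z)) (ParabolicDecay.cylMeasure Ω T) :=
    hGs.continuous.comp_aestronglyMeasurable hmain.1
  obtain ⟨hpos, hneg⟩ := ParabolicDecay.abs_Hfun_le hc
  have hbound : ∀ (m : ℝ) (p : ParabolicDecay.Space N × ℝ → Prop), 0 ≤ m →
      (∀ z, p z → m ≤ |ParabolicDecay.Hfun h (u n z)|) →
      volume.real {z ∈ ParabolicDecay.cyl Ω T | p z} * m ^ (2 * ((N : ℝ) + 2) / N) ≤
        4 ^ (2 * ((N : ℝ) + 2) / N) * A.toReal + 1 := fun m p hm hp =>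
    (ParabolicDecay.measureReal_mul_rpow_le hΩo hGm hr0 hAtop hmain.2 hm
      fun z hz => (hp z hz).trans (hHG _)).trans (by linarith)
  refine ⟨hbound _ _ (abs_nonneg _) fun z hz => hpos _ _ hk (le_of_lt hz),
    hbound _ _ (abs_nonneg _) fun z hz => hneg _ _ (by linarith) (le_of_lt hz),
    hbound _ _ (le_min (abs_nonneg _) (abs_nonneg _)) fun z hz => ?_⟩
  rcases lt_abs.1 hz with h1 | h1
  · exact (min_le_left _ _).trans (hpos _ _ hk h1.le)
  · exact (min_le_right _ _).trans (hneg _ _ (by linarith) (by linarith))
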